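/- Let $\mathbf k$ be a field and let $(A,\mu_1,\mu_2)$ be a matching dialgebra over $\mathbf k$: a vector space with two bilinear operations such that $\mu_j(\mu_i(x,y),z)=\mu_i(x,\mu_j(y,z))$ for all $i,j\in\{1,2\}$ and $x,y,z\in A$. Equivalently, $A$ is an algebra over the binary quadratic ns operad $As^{(2)}=\mathcal T(E)/(R)$, where $E=\mathbf k\{\mu_1,\mu_2\}$ and $R$ is spanned by the relators of these identities. Let $As^{(2)¡}=\mathcal C(sE,s^2R)$ be its Koszul dual cooperad, that is, the largest sub-cooperad of the cofree conilpotent ns cooperad $\mathcal T^c(sE)$ (with $sE$ in degree $1$) whose weight-two part lies in $s^2R$. Let $\Delta_{(1)}$ be its infinitesimal decomposition map, let $\kappa: As^{(2)¡}\twoheadrightarrow sE\cong E\hookrightarrow As^{(2)}$ be the canonical degree $-1$ morphism, and let $\gamma_A$ be the structure map of the $As^{(2)}$-algebra $A$. The Koszul complex of $A$ is $$As^{(2)¡}(A)=\bigoplus_{n\ge 1}\mathcal C_{n-1}(A),\qquad \mathcal C_{n-1}(A)=As^{(2)¡}_n\otimes A^{\otimes n},$$ with $d$ the composite of $\Delta_{(1)}$,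 $\mathrm{id}\circ_{(1)}\kappa$ and $\mathrm{id}\circ\gamma_A$ (with Koszul signs). For $\lambda\in As^{(2)¡}_n$ and $1\le i\le n-1$, let $$\Delta^i(\lambda)\in As^{(2)¡}_{n-1}\otimes E$$ be the component of the infinitesimal decomposition of $\lambda$ that splits off a binary cooperation at the $i$-th input. It is taken in the operadic desuspension $\mathcal S^c\otimes_H As^{(2)¡}$, which is the cooperad concentrated in degree $0$ on the same spaces (where $\mathcal S^c=\mathrm{End}^c_{s\mathbf k}$); explicitly, $\Delta^i$ is $(-1)^{n-1-i}$ times the corresponding component of $\Delta_{(1)}$, with $sE$ identified with $E$. Then each $\Delta^i(\lambda)$ is a finite sum $\sum_j \xi_{ij}\otimes\mu_{ij}$ with $\xi_{ij}\in As^{(2)¡}_{n-1}$ and $\mu_{ij}\in E$, and for every such expansion and all $a_1,\dots,a_n\in A$, $$d\bigl(\lambda\otimes(a_1\otimes\cdots\otimes a_n)\bigr)=\sum_{i=1}^{n-1}(-1)^{i+1}\sum_j \xi_{ij}\otimes\bigl(a_1\otimes\cdots\otimes a_{i-1}\otimes\mu_{ij}(a_i,a_{i+1})\otimes a_{i+2}\otimes\cdots\otimes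 a_n\bigr)\in\mathcal C_{n-2}(A).$$ In particular $d=0$ on $\mathcal C_0(A)$. Moreover $d\circ d=0$. -/

import Mathlib

open scoped TensorProduct DirectSum

universe u v w

/-! ### Planar binary trees with vertices decorated by a set of binary generators -/

/-- Planar binary trees whose internal vertices are decorated by `ι`. -/
inductive PTree (ι : Type u) : Type u
  | leaf : PTree ι
  | node (e : ι) (s t : PTree ι) : PTree ι

namespace PTree

variable {ι : Type u}

/-- The number of leaves (the arity). -/
def numLeaves : PTree ι → ℕ
  | leaf => 1
  | node _ s t => s.numLeaves + t.numLeaves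

/-- The number of internal vertices (the weight). -/
def numNodes : PTree ι → ℕ
  | leaf => 0
  | node _ s t => s.numNodes + t.numNodes + 1

/-- `graft s l u` is the tree `s` with its leaf number `l` (counted from the left, starting
from `0`) replaced by the tree `u`. -/
def graft : PTree ι → ℕ → PTree ι → PTree ι
  | leaf, 0, u => u
  | leaf, _ + 1, _ => leaf
  | node e s t, l, u =>
      if l < s.numLeaves then node e (graft s l u) t
      else node e s (graft t (l - s.numLeaves) u)

/-- The number of internal vertices of a tree that come after its leaf number `l` when the tree
is read in prefix order (root, left subtree, right subtree). -/
def nodesAfter : PTree ι → ℕ → ℕ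
  | leaf, _ => 0
  | node _ s t, l =>
      if l < s.numLeaves then s.nodesAfter l + t.numNodes
      else t.nodesAfter (l - s.numLeaves)

theorem numLeaves_pos : (t : PTree ι) → 0 < t.numLeaves
  | leaf => Nat.one_pos
  | node _ s t => Nat.add_pos_left (numLeaves_pos s) _

theorem numLeaves_graft (s u : PTree ι) (l : ℕ) (hl : l < s.numLeaves) :
    (graft s l u).numLeaves + 1 = s.numLeaves + u.numLeaves := by
  induction s generalizing l with
  | leaf =>
      have h0 : l = 0 := by simpa [numLeaves] using hl
      subst h0
      simp only [graft, numLeaves]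
      omega
  | node e s t ihs iht =>
      simp only [numLeaves] at hl
      by_cases h : l < s.numLeaves
      · have := ihs l h
        simp only [graft, if_pos h, numLeaves]
        omega
      · have := iht (l - s.numLeaves) (by omega)
        simp only [graft, if_neg h, numLeaves]
        omega

theorem finite_numLeaves_le [Finite ι] (n : ℕ) : {t : PTree ι | t.numLeaves ≤ n}.Finite := by
  induction n with
  | zero =>
      refine Set.Finite.subset Set.finite_empty ?_
      intro t ht
      have := numLeaves_pos t
      simp only [Set.mem_ofPred_eq] at ht
      omega
  | succ n ih =>
      have hfin : (insert leaf ((fun x : ι × PTree ι × PTree ι => node x.1 x.2.1 x.2.2) ''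
          (Set.univ ×ˢ ({t : PTree ι | t.numLeaves ≤ n} ×ˢ {t : PTree ι | t.numLeaves ≤ n}))) :
          Set (PTree ι)).Finite :=
        (((Set.finite_univ).prod (ih.prod ih)).image _).insert _
      refine hfin.subset ?_
      intro t ht
      cases t with
      | leaf => exact Set.mem_insert _ _
      | node e s t =>
          have h1 := numLeaves_pos s
          have h2 := numLeaves_pos t
          simp only [Set.mem_ofPred_eq, numLeaves] at ht
          refine Set.mem_insert_of_mem _ ⟨(e, s, t), ⟨Set.mem_univ _, ?_, ?_⟩, rfl⟩
          · show s.numLeaves ≤ n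
            omega
          · show t.numLeaves ≤ n
            omega

end PTree

/-- Planar binary trees with `n` leaves. -/
abbrev TreeOf (ι : Type u) (n : ℕ) : Type u := {t : PTree ι // t.numLeaves = n}

instance TreeOf.instFinite (ι : Type u) [Finite ι] (n : ℕ) : Finite (TreeOf ι n) :=
  ((PTree.finite_numLeaves_le n).subset
    (fun t (ht : t.numLeaves = n) => le_of_eq ht) : {t : PTree ι | t.numLeaves = n}.Finite)

noncomputable instance TreeOf.instFintype (ι : Type u) [Finite ι] (n : ℕ) : Fintype (TreeOf ι n) :=
  Fintype.ofFinite _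

/-- Grafting of a tree with `q` leaves on the leaf `l` of a tree with `p` leaves. -/
def TreeOf.graft {ι : Type u} {n p q : ℕ} (h : n + 1 = p + q) (l : Fin p)
    (s : TreeOf ι p) (u : TreeOf ι q) : TreeOf ι n :=
  ⟨PTree.graft s.1 l u.1, by
    have h1 := PTree.numLeaves_graft s.1 u.1 l (by rw [s.2]; exact l.2)
    rw [s.2, u.2] at h1
    omega⟩

/-- The corolla with two leaves and vertex `e`. -/
def TreeOf.corolla {ι : Type u} (e : ι) : TreeOf ι 2 := ⟨.node e .leaf .leaf, rfl⟩

/-- The space of arity `n` of the tree module on the space `E` of binary generators with basis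
`ι`: it is spanned by the planar binary trees with `n` leaves and vertices decorated by `ι`.
It underlies the free ns operad `T(E)`. It also underlies the cofree conilpotent ns cooperad
`T^c(sE)`, where `sE` is `E` placed in homological degree `1`; then the tree `t` stands for
the tensor of the suspended decorations of its vertices, in prefix order, and has degree
`n - 1`. -/
abbrev TreeModule (k : Type v) [Field k] (ι : Type u) (n : ℕ) : Type (max u v) := TreeOf ι n →₀ k

/-- The inclusion of `E = k^ι` in the tree module as its part of arity two. -/
noncomputable def generator (k : Type v) [Field k] {ι : Type u} [Fintype ι] (c : ι → k) :
    TreeModule k ι 2 :=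
  ∑ e, Finsupp.single (TreeOf.corolla e) (c e)

/-! ### The free ns operad and quadratic ns operads -/

section Operad

variable {k : Type v} [Field k] {ι : Type u}

/-- The partial composition `x ∘ y` at the input `l` (counted from `0`) in the free ns operad
`T(E)`. -/
noncomputable def partialComp {n p q : ℕ} (h : n + 1 = p + q) (l : Fin p) :
    TreeModule k ι p →ₗ[k] TreeModule k ι q →ₗ[k] TreeModule k ι n :=
  Finsupp.linearCombination k
    (fun s : TreeOf ι p => Finsupp.lmapDomain k k (TreeOf.graft h l s))

/-- Operadic ideals of the free ns operad. -/
def IsOperadicIdeal (I : ∀ n, Submodule k (TreeModule k ι n)) : Prop :=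
  ∀ (n p q : ℕ) (h : n + 1 = p + q) (l : Fin p) (x : TreeModule k ι p) (y : TreeModule k ι q),
    x ∈ I p ∨ y ∈ I q → partialComp h l x y ∈ I n

/-- The operadic ideal `(R)` of `T(E)` generated by a space `R` of quadratic relations. -/
noncomputable def relationIdeal (R : Submodule k (TreeModule k ι 3)) (n : ℕ) :
    Submodule k (TreeModule k ι n) :=
  sInf {J | ∃ I : ∀ m, Submodule k (TreeModule k ι m),
    IsOperadicIdeal I ∧ R ≤ I 3 ∧ J = I n}

/-- The component of arity `n` of the binary quadratic ns operad `P(E, R) = T(E) / (R)`. -/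
abbrev QuadraticOperad (R : Submodule k (TreeModule k ι 3)) (n : ℕ) : Type (max u v) :=
  TreeModule k ι n ⧸ relationIdeal R n

end Operad

/-! ### Algebras over a binary quadratic ns operad -/

section Algebra

variable {k : Type v} [Field k] {ι : Type u} {A : Type w} [AddCommGroup A] [Module k A]

/-- The operation on `A` defined by a tree, given the operations of its vertices. -/
noncomputable def treeEval (op : ι → A →ₗ[k] A →ₗ[k] A) :
    (t : PTree ι) → MultilinearMap k (fun _ : Fin t.numLeaves => A) A
  | .leaf => MultilinearMap.ofSubsingleton k A A (0 : Fin 1) LinearMap.id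
  | .node e s t =>
      (TensorProduct.lift (op e)).compMultilinearMap
        (((treeEval op s).domCoprod (treeEval op t)).domDomCongr finSumFinEquiv)

/-- The action of the free ns operad `T(E)` on `A`. -/
noncomputable def freeAction (op : ι → A →ₗ[k] A →ₗ[k] A) (n : ℕ) :
    TreeModule k ι n →ₗ[k] MultilinearMap k (fun _ : Fin n => A) A :=
  Finsupp.linearCombination k
    (fun t : TreeOf ι n => (treeEval op t.1).domDomCongr (finCongr t.2))

/-- The sequence of length `p` obtained from a sequence `a` of length `n` by replacing the block
of `q` entries that starts at position `l` by its image under `f`. -/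
def contractSeq {n p q : ℕ} (h : n + 1 = p + q) (l : Fin p) (f : (Fin q → A) → A)
    (a : Fin n → A) : Fin p → A := fun j =>
  if h1 : (j : ℕ) < l then a ⟨j, by omega⟩
  else if h2 : (j : ℕ) = l then f (fun t => a ⟨l + t, by omega⟩)
  else a ⟨j + q - 1, by omega⟩

/-- Auxiliary form of `treeEval` on infinite sequences. -/
def seqEval (op : ι → A →ₗ[k] A →ₗ[k] A) : PTree ι → (ℕ → A) → A
  | .leaf, a => a 0
  | .node e s t, a => op e (seqEval op s a) (seqEval op t (fun j => a (s.numLeaves + j)))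

theorem seqEval_congr (op : ι → A →ₗ[k] A →ₗ[k] A) (t : PTree ι) (a b : ℕ → A)
    (hab : ∀ j, j < t.numLeaves → a j = b j) : seqEval op t a = seqEval op t b := by
  induction t generalizing a b with
  | leaf => exact hab 0 Nat.one_pos
  | node e s t ihs iht =>
      simp only [PTree.numLeaves] at hab
      simp only [seqEval]
      rw [ihs a b (fun j hj => hab j (by omega)),
        iht _ (fun j => b (s.numLeaves + j)) (fun j hj => hab _ (by omega))]

theorem treeEval_eq_seqEval (op : ι → A →ₗ[k] A →ₗ[k] A) (t : PTree ι)
    (a : Fin t.numLeaves → A) (b : ℕ → A) (hab : ∀ j : Fin t.numLeaves, b j = a j) :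
    treeEval op t a = seqEval op t b := by
  induction t generalizing b with
  | leaf => exact (hab (0 : Fin 1)).symm
  | node e s t ihs iht =>
      have h1 := ihs (fun j => a (Fin.castAdd t.numLeaves j)) b
        (fun j => hab (Fin.castAdd t.numLeaves j))
      have h2 := iht (fun j => a (Fin.natAdd s.numLeaves j)) (fun j => b (s.numLeaves + j))
        (fun j => hab (Fin.natAdd s.numLeaves j))
      simp only [seqEval]
      rw [← h1, ← h2]
      change op e (treeEval op s _) (treeEval op t _) = _
      rfl

theorem seqEval_graft (op : ι → A →ₗ[k] A →ₗ[k] A) (s u : PTree ι) (l : ℕ)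
    (hl : l < s.numLeaves) (a : ℕ → A) :
    seqEval op (s.graft l u) a = seqEval op s (fun j =>
      if j < l then a j else if j = l then seqEval op u (fun t => a (l + t))
      else a (j + u.numLeaves - 1)) := by
  induction s generalizing l a with
  | leaf =>
      have h0 : l = 0 := by simpa [PTree.numLeaves] using hl
      subst h0
      simp [PTree.graft, seqEval]
  | node e s t ihs iht =>
      simp only [PTree.numLeaves] at hl
      by_cases h : l < s.numLeaves
      · have hn := PTree.numLeaves_graft s u l h
        simp only [PTree.graft, if_pos h, seqEval]
        rw [ihs l h]
        congr 1
        refine seqEval_congr op t _ _ (fun j _ => ?_)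
        rw [if_neg (by omega), if_neg (by omega)]
        congr 1
        omega
      · simp only [PTree.graft, if_neg h, seqEval]
        rw [iht (l - s.numLeaves) (by omega)]
        congr 1
        · congr 1
          refine seqEval_congr op s _ _ (fun j hj => ?_)
          rw [if_pos (by omega)]
        · refine seqEval_congr op t _ _ (fun j _ => ?_)
          have hu := PTree.numLeaves_pos u
          rcases lt_trichotomy j (l - s.numLeaves) with h1 | h1 | h1
          · rw [if_pos h1, if_pos (by omega)]
          · have e1 : ¬ j < l - s.numLeaves := by omega
            have e2 : ¬ s.numLeaves + j < l := by omega
            have e3 : s.numLeaves + j = l := by omega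
            simp only [if_neg e1, if_pos h1, if_neg e2, if_pos e3]
            refine seqEval_congr op u _ _ (fun i _ => ?_)
            congr 1
            omega
          · have e1 : ¬ j < l - s.numLeaves := by omega
            have e2 : ¬ s.numLeaves + j < l := by omega
            have e3 : ¬ s.numLeaves + j = l := by omega
            have e4 : ¬ j = l - s.numLeaves := by omega
            simp only [if_neg e1, if_neg e4, if_neg e2, if_neg e3]
            congr 1
            omega

theorem freeAction_single (op : ι → A →ₗ[k] A →ₗ[k] A) {n : ℕ} (t : TreeOf ι n)
    (a : Fin n → A) (b : ℕ → A) (hab : ∀ j : Fin n, b j = a j) :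
    freeAction op n (Finsupp.single t 1) a = seqEval op t.1 b := by
  obtain ⟨t, rfl⟩ := t
  simp only [freeAction, Finsupp.linearCombination_single, one_smul,
    MultilinearMap.domDomCongr_apply]
  exact treeEval_eq_seqEval op t _ b hab

theorem freeAction_partialComp (op : ι → A →ₗ[k] A →ₗ[k] A) {n p q : ℕ} (h : n + 1 = p + q)
    (l : Fin p) (x : TreeModule k ι p) (y : TreeModule k ι q) (a : Fin n → A) :
    freeAction op n (partialComp h l x y) a =
      freeAction op p x (contractSeq h l (freeAction op q y) a) := by
  have hlin : ∀ (c : k) (y : TreeModule k ι q), contractSeq h l (freeAction op q (c • y)) a =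
      Function.update (contractSeq h l (freeAction op q y) a) l
        (c • contractSeq h l (freeAction op q y) a l) := by
    intro c y
    funext j
    by_cases hj : j = l
    · subst hj; simp [contractSeq]
    · have hj' : (j : ℕ) ≠ l := fun hh => hj (Fin.ext hh)
      rw [Function.update_of_ne hj]
      simp [contractSeq, hj']
  have hadd : ∀ (y z : TreeModule k ι q), freeAction op p x
        (contractSeq h l (freeAction op q (y + z)) a) =
      freeAction op p x (contractSeq h l (freeAction op q y) a) +
        freeAction op p x (contractSeq h l (freeAction op q z) a) := by
    intro y z
    have key : ∀ w : TreeModule k ι q, contractSeq h l (freeAction op q w) a =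
        Function.update (contractSeq h l (freeAction op q y) a) l
          (contractSeq h l (freeAction op q w) a l) := by
      intro w
      funext j
      by_cases hj : j = l
      · subst hj; simp
      · have hj' : (j : ℕ) ≠ l := fun hh => hj (Fin.ext hh)
        rw [Function.update_of_ne hj]
        simp [contractSeq, hj']
    rw [key (y + z), key z]
    have : contractSeq h l (freeAction op q (y + z)) a l =
        contractSeq h l (freeAction op q y) a l + contractSeq h l (freeAction op q z) a l := by
      simp [contractSeq]
    rw [this, MultilinearMap.map_update_add, Function.update_eq_self]
  have hsmul : ∀ (c : k) (y : TreeModule k ι q), freeAction op p x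
        (contractSeq h l (freeAction op q (c • y)) a) =
      c • freeAction op p x (contractSeq h l (freeAction op q y) a) := by
    intro c y
    rw [hlin, MultilinearMap.map_update_smul, Function.update_eq_self]
  induction y using Finsupp.induction_linear with
  | zero =>
      have := hsmul 0 0
      rw [zero_smul, zero_smul] at this
      rw [this]
      simp
  | add y z hy hz => rw [map_add, map_add, add_apply, hy, hz, hadd]
  | single u c =>
      have hu : (Finsupp.single u c : TreeModule k ι q) = c • Finsupp.single u 1 := by simp
      rw [hu, hsmul, map_smul, map_smul, smul_apply]
      congr 1
      clear hu hlin hadd hsmul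
      induction x using Finsupp.induction_linear with
      | zero => simp
      | add x z hx hz =>
          rw [map_add, LinearMap.add_apply, map_add, map_add, add_apply,
            add_apply, hx, hz]
      | single s c =>
          have hs : (Finsupp.single s c : TreeModule k ι p) = c • Finsupp.single s 1 := by simp
          rw [hs, map_smul, map_smul, LinearMap.smul_apply, map_smul, smul_apply,
            smul_apply]
          congr 1
          have hc : partialComp h l (Finsupp.single s 1 : TreeModule k ι p)
              (Finsupp.single u 1 : TreeModule k ι q) =
              Finsupp.single (TreeOf.graft h l s u) 1 := by
            simp [partialComp, Finsupp.linearCombination_single]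
          have hb : ∀ {m : ℕ} (a : Fin m → A) (j : Fin m),
              (fun i : ℕ => if hi : i < m then a ⟨i, hi⟩ else 0) j = a j := by
            intro m a j
            simp
          rw [hc, freeAction_single op (TreeOf.graft h l s u) a
              (fun i : ℕ => if hi : i < n then a ⟨i, hi⟩ else 0) (hb a),
            freeAction_single op s _
              (fun i : ℕ => if hi : i < p then contractSeq h l
                (freeAction op q (Finsupp.single u 1)) a ⟨i, hi⟩ else 0) (hb _)]
          simp only [TreeOf.graft]
          rw [seqEval_graft op s.1 u.1 l (by rw [s.2]; exact l.2)]
          refine seqEval_congr op s.1 _ _ (fun j hj => ?_)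
          rw [s.2] at hj
          have hl := l.2
          simp only [hj, dif_pos, contractSeq]
          by_cases h1 : j < (l : ℕ)
          · simp only [h1, if_true, dif_pos]
            rw [dif_pos (by have := u.1.numLeaves_pos; have := u.2; omega)]
          · by_cases h2 : j = (l : ℕ)
            · simp only [h2, lt_irrefl, if_true, if_false, dif_pos, dif_neg, not_false_eq_true]
              rw [freeAction_single op u _
                (fun i : ℕ => if hi : i < q then a ⟨l + i, by omega⟩ else 0)
                (fun i => by simp)]
              refine seqEval_congr op u.1 _ _ (fun i hi => ?_)
              rw [u.2] at hi
              rw [dif_pos (by omega), dif_pos hi]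
            · simp only [h1, h2, if_false, dif_neg, not_false_eq_true, u.2]
              rw [dif_pos (by omega)]

/-- The operations `op` make `A` an algebra over `P(E, R)`: they satisfy the relations `R`. -/
def SatisfiesRelations (R : Submodule k (TreeModule k ι 3)) (op : ι → A →ₗ[k] A →ₗ[k] A) : Prop :=
  R ≤ LinearMap.ker (freeAction op 3)

theorem relationIdeal_le_ker (R : Submodule k (TreeModule k ι 3)) (op : ι → A →ₗ[k] A →ₗ[k] A)
    (hop : SatisfiesRelations R op) (n : ℕ) :
    relationIdeal R n ≤ LinearMap.ker (freeAction op n) := by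
  refine sInf_le ⟨fun m => LinearMap.ker (freeAction op m), ?_, hop, rfl⟩
  intro n p q h l x y hxy
  rw [LinearMap.mem_ker]
  ext a
  rw [freeAction_partialComp]
  rcases hxy with hx | hy
  · rw [LinearMap.mem_ker] at hx
    rw [hx]
    rfl
  · rw [LinearMap.mem_ker] at hy
    rw [hy]
    exact MultilinearMap.map_coord_zero _ l (by simp [contractSeq])

/-- The structure maps `γ_A : P(E, R)_n ⊗ A^{⊗ n} → A` of an algebra over `P(E, R)`. -/
noncomputable def operadAction (R : Submodule k (TreeModule k ι 3)) (op : ι → A →ₗ[k] A →ₗ[k] A)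
    (hop : SatisfiesRelations R op) (n : ℕ) :
    QuadraticOperad R n →ₗ[k] MultilinearMap k (fun _ : Fin n => A) A :=
  (relationIdeal R n).liftQ (freeAction op n) (relationIdeal_le_ker R op hop n)

end Algebra

/-! ### The cofree ns cooperad and the Koszul dual cooperad -/

section Cooperad

variable {k : Type v} [Field k] {ι : Type u} [Finite ι]

open Classical in
/-- The component, in arities `(p, q)` and at position `l` (counted from `0`), of the
infinitesimal decomposition map `Δ_(1)` of the cofree ns cooperad `T^c(sE)`: a tree `t` is sent
to the sum of the `± s ⊗ u` over the pairs such that grafting `u` on the leaf `l` of `s` gives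
`t`. The sign is the Koszul sign for bringing the word of `t` (its suspended decorations in prefix
order) to the word of `s` followed by that of `u`: the `q - 1` letters of `u` jump over the
letters of `s` that come after the leaf `l`. -/
noncomputable def decomp (k : Type v) [Field k] (ι : Type u) [Finite ι] (n p q : ℕ) (l : Fin p) :
    TreeModule k ι n →ₗ[k] TreeModule k ι p ⊗[k] TreeModule k ι q :=
  Finsupp.linearCombination k (fun t : TreeOf ι n =>
    ∑ s : TreeOf ι p, ∑ u : TreeOf ι q,
      if PTree.graft s.1 l u.1 = t.1 then
        ((-1 : k) ^ ((q - 1) * s.1.nodesAfter l)) •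
          ((Finsupp.single s 1 : TreeModule k ι p) ⊗ₜ[k] (Finsupp.single u 1 : TreeModule k ι q))
      else 0)

/-- Sub-cooperads of the cofree ns cooperad `T^c(sE)`. -/
def IsSubcooperad (C : ∀ n, Submodule k (TreeModule k ι n)) : Prop :=
  ∀ (n p q : ℕ) (l : Fin p) (x : TreeModule k ι n), x ∈ C n →
    decomp k ι n p q l x ∈ LinearMap.range (TensorProduct.mapIncl (C p) (C q))

/-- The Koszul dual cooperad `C(sE, s²R)` of the quadratic operad `P(E, R)`: the largest
sub-cooperad of `T^c(sE)` whose component of weight two (that is, of arity three) is contained in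
`s²R`. The identification `μ ∘ ν ↦ sμ ∘ sν` preserves the coordinates on trees, so that `s²R` is
`R` itself as a subspace of the tree module. -/
noncomputable def koszulDual (R : Submodule k (TreeModule k ι 3)) (n : ℕ) : Submodule k (TreeModule k ι n) :=
  sSup {J | ∃ C : ∀ m, Submodule k (TreeModule k ι m),
    IsSubcooperad C ∧ C 3 ≤ R ∧ J = C n}

theorem koszulDual_isSubcooperad (R : Submodule k (TreeModule k ι 3)) :
    IsSubcooperad (koszulDual R) := by
  intro n p q l x hx
  suffices h : koszulDual R n ≤ (LinearMap.range
      (TensorProduct.mapIncl (koszulDual R p) (koszulDual R q))).comap (decomp k ι n p q l) from h hx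
  refine sSup_le ?_
  rintro J ⟨C, hC, h3, rfl⟩ y hy
  have hp : C p ≤ koszulDual R p := le_sSup ⟨C, hC, h3, rfl⟩
  have hq : C q ≤ koszulDual R q := le_sSup ⟨C, hC, h3, rfl⟩
  obtain ⟨z, hz⟩ := hC n p q l y hy
  refine ⟨TensorProduct.map (Submodule.inclusion hp) (Submodule.inclusion hq) z, ?_⟩
  rw [← hz, TensorProduct.mapIncl, TensorProduct.mapIncl, ← LinearMap.comp_apply,
    ← TensorProduct.map_comp]
  rfl

theorem mapIncl_injective_of_field {V W : Type*} [AddCommGroup V] [Module k V] [AddCommGroup W]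
    [Module k W] (C : Submodule k V) (D : Submodule k W) :
    Function.Injective (TensorProduct.mapIncl C D) :=
  TensorProduct.map_injective_of_flat_flat' _ _
    (Submodule.injective_subtype _) (Submodule.injective_subtype _)

theorem koszulDual_mapIncl_injective (R : Submodule k (TreeModule k ι 3)) (p q : ℕ) :
    Function.Injective (TensorProduct.mapIncl (koszulDual R p) (koszulDual R q)) :=
  mapIncl_injective_of_field (koszulDual R p) (koszulDual R q)

/-- The components of the infinitesimal decomposition map of the Koszul dual cooperad. -/
noncomputable def koszulDecomp (R : Submodule k (TreeModule k ι 3)) (n p q : ℕ) (l : Fin p) :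
    koszulDual R n →ₗ[k] koszulDual R p ⊗[k] koszulDual R q :=
  (LinearEquiv.ofInjective _ (koszulDual_mapIncl_injective R p q)).symm.toLinearMap ∘ₗ
    LinearMap.codRestrict _ ((decomp k ι n p q l) ∘ₗ (koszulDual R n).subtype)
      (fun x => koszulDual_isSubcooperad R n p q l x.1 x.2)

/-- The components of the infinitesimal decomposition map of the operadic desuspension
`S^c ⊗_H C(sE, s²R)` of the Koszul dual cooperad. This is a cooperad concentrated in degree `0`,
on the same spaces. Here `S^c(n)` is spanned by the map `(sk)^{⊗ n} → sk` of degree `1 - n`;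
its decomposition has the sign `(-1)^{(q-1)l}` and the interchange of factors in the Hadamard
product has the sign `(-1)^{(q-1)(p-1)}`. -/
noncomputable def desuspendedDecomp (R : Submodule k (TreeModule k ι 3)) (n p q : ℕ) (l : Fin p) :
    koszulDual R n →ₗ[k] koszulDual R p ⊗[k] koszulDual R q :=
  ((-1 : k) ^ ((q - 1) * l + (q - 1) * (p - 1))) • koszulDecomp R n p q l

/-- The morphism `κ : C(sE, s²R) → sE → E → P(E, R)`; it has degree `-1` and vanishes outside
arity two. -/
noncomputable def koszulMorphism (R : Submodule k (TreeModule k ι 3)) (q : ℕ) :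
    koszulDual R q →ₗ[k] QuadraticOperad R q :=
  if q = 2 then (relationIdeal R q).mkQ ∘ₗ (koszulDual R q).subtype else 0

end Cooperad

/-! ### The Koszul complex of an algebra over a binary quadratic ns operad -/

section KoszulComplex

variable {k : Type v} [Field k] {ι : Type u} [Finite ι] {A : Type w} [AddCommGroup A] [Module k A]

theorem exists_contractSeq_update {n p q : ℕ} (h : n + 1 = p + q) (l : Fin p)
    (f : MultilinearMap k (fun _ : Fin q => A) A) (a : Fin n → A) (s : Fin n) :
    ∃ (j : Fin p) (g : A →ₗ[k] A), ∀ x, contractSeq h l f (Function.update a s x) =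
      Function.update (contractSeq h l f a) j (g x) := by
  have hl := l.2
  have hs := s.2
  rcases lt_or_ge (s : ℕ) l with h1 | h1
  · refine ⟨⟨s, by omega⟩, LinearMap.id, fun x => ?_⟩
    funext j
    by_cases hj : (j : ℕ) = s
    · have e : j = ⟨s, by omega⟩ := Fin.ext hj
      rw [e]
      simp [contractSeq, h1]
    · have hj' : j ≠ ⟨s, by omega⟩ := fun hh => hj (by rw [hh])
      rw [Function.update_of_ne hj']
      simp only [contractSeq]
      split_ifs with h2 h3
      · rw [Function.update_of_ne]
        exact fun hh => hj (congrArg Fin.val hh)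
      · congr 1
        funext t
        rw [Function.update_of_ne]
        intro hh
        have := congrArg Fin.val hh
        simp only at this
        omega
      · rw [Function.update_of_ne]
        intro hh
        have := congrArg Fin.val hh
        simp only at this
        omega
  · rcases lt_or_ge (s : ℕ) (l + q) with h2 | h2
    · refine ⟨l, f.toLinearMap (fun t => a ⟨l + t, by omega⟩) ⟨s - l, by omega⟩, fun x => ?_⟩
      funext j
      by_cases hj : j = l
      · subst hj
        simp only [contractSeq, lt_irrefl, dif_pos, dif_neg, not_false_eq_true,
          Function.update_self, MultilinearMap.toLinearMap_apply]
        congr 1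
        funext t
        by_cases ht : (t : ℕ) = s - j
        · have e' : t = ⟨s - j, by omega⟩ := Fin.ext ht
          rw [e']
          have e : (⟨(j : ℕ) + (s - j : ℕ), by omega⟩ : Fin n) = s := Fin.ext (by simp only; omega)
          simp only [e, Function.update_self]
        · rw [Function.update_of_ne, Function.update_of_ne]
          · exact fun hh => ht (congrArg Fin.val hh)
          · intro hh
            have := congrArg Fin.val hh
            simp only at this
            omega
      · rw [Function.update_of_ne hj]
        have hj' : (j : ℕ) ≠ l := fun hh => hj (Fin.ext hh)
        simp only [contractSeq, dif_neg hj']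
        split_ifs with h3
        · rw [Function.update_of_ne]
          intro hh
          have := congrArg Fin.val hh
          simp only at this
          omega
        · rw [Function.update_of_ne]
          intro hh
          have := congrArg Fin.val hh
          simp only at this
          omega
    · refine ⟨⟨s + 1 - q, by omega⟩, LinearMap.id, fun x => ?_⟩
      funext j
      by_cases hj : (j : ℕ) = s + 1 - q
      · have e' : j = ⟨s + 1 - q, by omega⟩ := Fin.ext hj
        rw [e']
        have e1 : ¬ ((s : ℕ) + 1 - q < l) := by omega
        have e2 : ¬ ((s : ℕ) + 1 - q = l) := by omega
        have e : (⟨(s : ℕ) + 1 - q + q - 1, by omega⟩ : Fin n) = s := Fin.ext (by simp only; omega)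
        simp only [contractSeq, dif_neg e1, dif_neg e2, e, Function.update_self, LinearMap.id_apply]
      · have hj' : j ≠ ⟨s + 1 - q, by omega⟩ := fun hh => hj (by rw [hh])
        rw [Function.update_of_ne hj']
        simp only [contractSeq]
        split_ifs with h3 h4
        · rw [Function.update_of_ne]
          intro hh
          have := congrArg Fin.val hh
          simp only at this
          omega
        · congr 1
          funext t
          rw [Function.update_of_ne]
          intro hh
          have := congrArg Fin.val hh
          simp only at this
          omega
        · rw [Function.update_of_ne]
          intro hh
          have := congrArg Fin.val hh
          simp only at this
          omega

/-- The application of an operation `f` with `q` inputs to the block of `q` factors of `A^{⊗ n}`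
that starts at position `l` (counted from `0`), that is, the map `id^{⊗ l} ⊗ f ⊗ id`. -/
noncomputable def contract {n p q : ℕ} (h : n + 1 = p + q) (l : Fin p) :
    MultilinearMap k (fun _ : Fin q => A) A →ₗ[k]
      (⨂[k] _ : Fin n, A) →ₗ[k] (⨂[k] _ : Fin p, A) where
  toFun f := PiTensorProduct.lift
    (MultilinearMap.mk' (fun a => PiTensorProduct.tprod k (contractSeq h l f a))
      (fun a s x y => by
        obtain ⟨j, g, hg⟩ := exists_contractSeq_update h l f a s
        rw [hg, hg, hg, map_add, MultilinearMap.map_update_add])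
      (fun a s c x => by
        obtain ⟨j, g, hg⟩ := exists_contractSeq_update h l f a s
        rw [hg, hg, map_smul, MultilinearMap.map_update_smul]))
  map_add' f g := by
    ext a
    have key : ∀ u : (Fin q → A) → A, contractSeq h l u a =
        Function.update (contractSeq h l f a) l (u (fun t => a ⟨l + t, by omega⟩)) := by
      intro u
      funext j
      by_cases hj : j = l
      · subst hj
        simp [contractSeq]
      · have hj' : (j : ℕ) ≠ l := fun hh => hj (Fin.ext hh)
        rw [Function.update_of_ne hj]
        simp [contractSeq, hj']
    simp only [LinearMap.compMultilinearMap_apply, PiTensorProduct.lift.tprod,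
      MultilinearMap.mk'_apply, LinearMap.add_apply]
    rw [key f, key g, key (f + g : MultilinearMap k (fun _ : Fin q => A) A), add_apply,
      MultilinearMap.map_update_add]
  map_smul' c f := by
    ext a
    have key : ∀ u : (Fin q → A) → A, contractSeq h l u a =
        Function.update (contractSeq h l f a) l (u (fun t => a ⟨l + t, by omega⟩)) := by
      intro u
      funext j
      by_cases hj : j = l
      · subst hj
        simp [contractSeq]
      · have hj' : (j : ℕ) ≠ l := fun hh => hj (Fin.ext hh)
        rw [Function.update_of_ne hj]
        simp [contractSeq, hj']
    simp only [LinearMap.compMultilinearMap_apply, PiTensorProduct.lift.tprod,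
      MultilinearMap.mk'_apply, LinearMap.smul_apply, RingHom.id_apply]
    rw [key f, key (c • f : MultilinearMap k (fun _ : Fin q => A) A), smul_apply,
      MultilinearMap.map_update_smul]

/-- The component of arity `n`, hence of homological degree `n - 1`, of the Koszul complex of an
algebra over `P(E, R)`. -/
abbrev KoszulComponent (R : Submodule k (TreeModule k ι 3)) (A : Type w) [AddCommGroup A]
    [Module k A] (n : ℕ) : Type (max u v w) :=
  koszulDual R n ⊗[k] (⨂[k] _ : Fin n, A)

/-- The underlying space `C(sE, s²R)(A) = ⨁ₙ C(sE, s²R)ₙ ⊗ A^{⊗ n}` of the Koszul complex. -/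
abbrev KoszulSpace (R : Submodule k (TreeModule k ι 3)) (A : Type w) [AddCommGroup A]
    [Module k A] : Type (max u v w) :=
  ⨁ n : ℕ, KoszulComponent R A n

/-- The component at `(p, q, l)` of the composite
`C(A) → (C ∘_(1) C)(A) → (C ∘_(1) P)(A) → C(A)` of `Δ_(1)`, `id ∘_(1) κ` and `id ∘ γ_A`, where
`C = C(sE, s²R)`. As `κ` has degree `-1`, the Koszul sign rule gives
`(id ⊗ κ)(ξ ⊗ μ) = (-1)^{|ξ|} ξ ⊗ κ(μ)`, where `|ξ| = p - 1` for `ξ` of arity `p`. -/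
noncomputable def koszulDifferentialPart (R : Submodule k (TreeModule k ι 3))
    (op : ι → A →ₗ[k] A →ₗ[k] A) (hop : SatisfiesRelations R op) {n p q : ℕ}
    (h : n + 1 = p + q) (l : Fin p) : KoszulComponent R A n →ₗ[k] KoszulComponent R A p :=
  ((-1 : k) ^ (p - 1)) •
    (TensorProduct.map LinearMap.id (TensorProduct.lift
        (contract h l ∘ₗ operadAction R op hop q ∘ₗ koszulMorphism R q)) ∘ₗ
      (TensorProduct.assoc k (koszulDual R p) (koszulDual R q) (⨂[k] _ : Fin n, A)).toLinearMap ∘ₗ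
      TensorProduct.map (koszulDecomp R n p q l) LinearMap.id)

/-- The differential of the Koszul complex: the sum of the previous composites over all the
components `C_n → C_p ⊗ C_q` of `Δ_(1)`. -/
noncomputable def koszulDifferential (R : Submodule k (TreeModule k ι 3))
    (op : ι → A →ₗ[k] A →ₗ[k] A) (hop : SatisfiesRelations R op) :
    KoszulSpace R A →ₗ[k] KoszulSpace R A :=
  DirectSum.toModule k ℕ (KoszulSpace R A) (fun n =>
    ∑ p : Fin (n + 2), ∑ l : Fin p,
      DirectSum.lof k ℕ (KoszulComponent R A) p ∘ₗ
        koszulDifferentialPart R op hop (q := n + 1 - p) (by omega) l)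

end KoszulComplex

/-! ### Matching dialgebras -/

/-- A matching dialgebra structure on a vector space `A`. -/
structure MatchingDialgebra (k : Type v) [Field k] (A : Type w) [AddCommGroup A] [Module k A] where
  /-- The first operation. -/
  mul₁ : A →ₗ[k] A →ₗ[k] A
  /-- The second operation. -/
  mul₂ : A →ₗ[k] A →ₗ[k] A
  assoc₁ : ∀ x y z, mul₁ (mul₁ x y) z = mul₁ x (mul₁ y z)
  assoc₂ : ∀ x y z, mul₂ (mul₂ x y) z = mul₂ x (mul₂ y z)
  match₁₂ : ∀ x y z, mul₂ (mul₁ x y) z = mul₁ x (mul₂ y z)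
  match₂₁ : ∀ x y z, mul₁ (mul₂ x y) z = mul₂ x (mul₁ y z)

/-- The space of relations of the operad `As^(2)` of matching dialgebras. It is spanned by the
relators of `(x μᵢ y) μⱼ z = x μᵢ (y μⱼ z)`. -/
noncomputable def matchingRelations (k : Type v) [Field k] : Submodule k (TreeModule k (Fin 2) 3) :=
  Submodule.span k (Set.range (fun ij : Fin 2 × Fin 2 =>
    (Finsupp.single ⟨.node ij.2 (.node ij.1 .leaf .leaf) .leaf, rfl⟩ 1 -
      Finsupp.single ⟨.node ij.1 .leaf (.node ij.2 .leaf .leaf), rfl⟩ 1 :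
        TreeModule k (Fin 2) 3)))

namespace MatchingDialgebra

variable {k : Type v} [Field k] {A : Type w} [AddCommGroup A] [Module k A]

/-- The two operations, as a family. -/
def op (M : MatchingDialgebra k A) : Fin 2 → A →ₗ[k] A →ₗ[k] A := ![M.mul₁, M.mul₂]

/-- The operation `c₁ μ₁ + c₂ μ₂` on `A` defined by an element of `E = k{μ₁, μ₂}`. -/
noncomputable def opE (M : MatchingDialgebra k A) (c : Fin 2 → k) : A →ₗ[k] A →ₗ[k] A :=
  c 0 • M.mul₁ + c 1 • M.mul₂

theorem satisfiesRelations (M : MatchingDialgebra k A) :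
    SatisfiesRelations (matchingRelations k) M.op := by
  refine Submodule.span_le.2 ?_
  rintro _ ⟨⟨i, j⟩, rfl⟩
  rw [SetLike.mem_coe, LinearMap.mem_ker, map_sub, sub_eq_zero]
  ext a
  have hb : ∀ j : Fin 3, (fun i : ℕ => if hi : i < 3 then a ⟨i, hi⟩ else 0) j = a j := by
    intro j
    simp
  rw [freeAction_single M.op _ a (fun i : ℕ => if hi : i < 3 then a ⟨i, hi⟩ else 0) hb,
    freeAction_single M.op _ a (fun i : ℕ => if hi : i < 3 then a ⟨i, hi⟩ else 0) hb]
  fin_cases i <;> fin_cases j <;>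
    simp [seqEval, op, PTree.numLeaves, M.assoc₁, M.assoc₂, M.match₁₂, M.match₂₁]

end MatchingDialgebra

/-- The Koszul dual cooperad of the operad `As^(2)`. -/
noncomputable abbrev AsTwoDual (k : Type v) [Field k] (n : ℕ) :
    Submodule k (TreeModule k (Fin 2) n) :=
  koszulDual (matchingRelations k) n

/-- The Koszul complex of a matching dialgebra: the space. -/
abbrev MatchingDialgebra.Complex {k : Type v} [Field k] {A : Type w} [AddCommGroup A] [Module k A]
    (_M : MatchingDialgebra k A) : Type (max v w) :=
  KoszulSpace (matchingRelations k) A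

/-- The Koszul complex of a matching dialgebra: the differential. -/
noncomputable def MatchingDialgebra.d {k : Type v} [Field k] {A : Type w} [AddCommGroup A]
    [Module k A] (M : MatchingDialgebra k A) : M.Complex →ₗ[k] M.Complex :=
  koszulDifferential (matchingRelations k) M.op M.satisfiesRelations

/-! Since κ vanishes outside arity two, only the components C_{n+1} → C_n ⊗ C_2 of Δ_(1) contribute
to d (`koszulDifferential_lof_succ`). The formula for d is then a matter of signs. At the position
i, counted from 0, moving κ past a cooperation of arity n costs (-1)^{n-1}, the desuspension costs
(-1)^{i+n-1}, and the product is (-1)^i (`koszulDifferentialPart_tmul_tprod`).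

For d² = 0, an element of C_n ⊗ X is determined by its coordinates on the trees s of the left
factor, because over a field C_n ⊗ X embeds in T(E)_n ⊗ X (`subCoord_ext`). Up to one global sign,
the coordinate of d²(x ⊗ z) on s is a sum over pairs of positions (l, m) and corollas u, v: the
coefficient of x on the tree s with u grafted at l and then v at m, times z contracted by v at m and
then by u at l (`squareTerm`).

If v is not grafted on u, the two graftings can be exchanged. The tree and the contraction stay the
same but the sign changes, since one vertex of degree one has passed another
(`squareTerm_add_of_lt`). If v is grafted on a leaf of u, the signs are trivial, and the terms of
the two leaves together run once over all trees t with three leaves grafted on s at l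
(`squareTerm_add_of_eq`). The coefficients of x on these trees form an element of C_3, as C is a
sub-cooperad; hence they form an element of R, which acts by zero on A
(`sum_graft_smul_treeContract_eq_zero`). This part works for any quadratic relations R on finitely
many binary generators; As^(2) enters only at the end. -/

namespace PTree

variable {ι : Type u}

/-! ### Grafting of planar binary trees and the prefix order of their vertices. -/

theorem numLeaves_eq_numNodes_add_one (t : PTree ι) : t.numLeaves = t.numNodes + 1 := by
  induction t with
  | leaf => rfl
  | node e s t ihs iht => simp only [numLeaves, numNodes]; omega

/-- In prefix order the vertices of `u` take the place of leaf `l`, which comes after leaf `m`, so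
all of them are counted. For a corolla `u` this extra 1 is the source of the minus sign in
`squareTerm_add_of_lt`. -/
theorem nodesAfter_graft_of_lt (s u : PTree ι) (l m : ℕ) (hml : m < l) (hl : l < s.numLeaves) :
    (s.graft l u).nodesAfter m = s.nodesAfter m + u.numNodes := by
  induction s generalizing l m with
  | leaf => simp only [numLeaves] at hl; omega
  | node e s t ihs iht =>
      simp only [numLeaves] at hl
      by_cases h : l < s.numLeaves
      · have hn := numLeaves_graft s u l h
        have hu := numLeaves_pos u
        rw [graft, if_pos h, nodesAfter, nodesAfter, if_pos (by omega), if_pos (by omega),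
          ihs l m hml h]
        omega
      · rw [graft, if_neg h, nodesAfter, nodesAfter]
        by_cases hm : m < s.numLeaves
        -- Here `m` lies in the left subtree and `u` goes into the right one, all of whose vertices
        -- come after `m`; they are counted through their leaves.
        · have hn := numLeaves_graft t u (l - s.numLeaves) (by omega)
          have h1 := numLeaves_eq_numNodes_add_one (t.graft (l - s.numLeaves) u)
          have h2 := numLeaves_eq_numNodes_add_one t
          have h3 := numLeaves_eq_numNodes_add_one u
          rw [if_pos hm, if_pos hm]
          omega
        · rw [if_neg hm, if_neg hm, iht _ _ (by omega) (by omega)]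

/-- The vertices of `u` now come before the leaf in question, so they are not counted; the leaf is
only renumbered from `m` to `m + u.numLeaves - 1`. -/
theorem nodesAfter_graft_of_gt (s u : PTree ι) (l m : ℕ) (hlm : l < m) (hm : m < s.numLeaves) :
    (s.graft l u).nodesAfter (m + u.numLeaves - 1) = s.nodesAfter m := by
  have hu := numLeaves_pos u
  induction s generalizing l m with
  | leaf => simp only [numLeaves] at hm; omega
  | node e s t ihs iht =>
      simp only [numLeaves] at hm
      by_cases h : l < s.numLeaves
      · have hn := numLeaves_graft s u l h
        rw [graft, if_pos h, nodesAfter, nodesAfter]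
        by_cases hm' : m < s.numLeaves
        · rw [if_pos (by omega), if_pos hm', ihs l m hlm hm']
        · rw [if_neg (by omega), if_neg hm']
          congr 1
          omega
      · rw [graft, if_neg h, nodesAfter, nodesAfter, if_neg (by omega), if_neg (by omega),
          ← iht (l - s.numLeaves) (m - s.numLeaves) (by omega) (by omega)]
        congr 1
        omega

/-- After leaf `i` of the grafted `u` come first the remaining vertices of `u`, then those of `s`
after the leaf `l`. -/
theorem nodesAfter_graft_add (s u : PTree ι) (l i : ℕ) (hl : l < s.numLeaves)
    (hi : i < u.numLeaves) :
    (s.graft l u).nodesAfter (l + i) = s.nodesAfter l + u.nodesAfter i := by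
  induction s generalizing l with
  | leaf =>
      have h0 : l = 0 := by simpa [numLeaves] using hl
      subst h0
      simp [graft, nodesAfter]
  | node e s t ihs iht =>
      simp only [numLeaves] at hl
      by_cases h : l < s.numLeaves
      · have hn := numLeaves_graft s u l h
        rw [graft, if_pos h, nodesAfter, nodesAfter, if_pos (by omega), if_pos h, ihs l h]
        omega
      · rw [graft, if_neg h, nodesAfter, nodesAfter, if_neg (by omega), if_neg h,
          ← iht (l - s.numLeaves) (by omega)]
        congr 1
        omega

/-- The sequential axiom of partial composition: `v` is grafted on a leaf that belongs to `u`. -/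
theorem graft_graft_add (s u v : PTree ι) (l i : ℕ) (hl : l < s.numLeaves)
    (hi : i < u.numLeaves) :
    (s.graft l u).graft (l + i) v = s.graft l (u.graft i v) := by
  induction s generalizing l with
  | leaf =>
      have h0 : l = 0 := by simpa [numLeaves] using hl
      subst h0
      simp [graft]
  | node e s t ihs iht =>
      simp only [numLeaves] at hl
      by_cases h : l < s.numLeaves
      · have hn := numLeaves_graft s u l h
        rw [graft, if_pos h, graft, if_pos (by omega), ihs l h, graft, if_pos h]
      · have e1 : l + i - s.numLeaves = l - s.numLeaves + i := by omega
        rw [graft, if_neg h, graft, if_neg (by omega), e1, iht _ (by omega), graft, if_neg h]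

/-- The parallel axiom of partial composition: `u` and `v` are grafted on two different leaves of
`s`. -/
theorem graft_graft_of_lt (s u v : PTree ι) (l m : ℕ) (hlm : l < m) (hm : m < s.numLeaves) :
    (s.graft l u).graft (m + u.numLeaves - 1) v = (s.graft m v).graft l u := by
  have hu := numLeaves_pos u
  induction s generalizing l m with
  | leaf => simp only [numLeaves] at hm; omega
  | node e s t ihs iht =>
      simp only [numLeaves] at hm
      by_cases h : l < s.numLeaves
      · have hn := numLeaves_graft s u l h
        by_cases hm' : m < s.numLeaves
        · have hn' := numLeaves_graft s v m hm'
          have hv := numLeaves_pos v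
          rw [graft, if_pos h, graft, if_pos (by omega), ihs l m hlm hm', graft, if_pos hm', graft,
            if_pos (by omega)]
        · rw [graft, if_pos h, graft, if_neg (by omega), graft, if_neg hm', graft, if_pos h]
          congr 2
          omega
      · have e1 : m + u.numLeaves - 1 - s.numLeaves = m - s.numLeaves + u.numLeaves - 1 := by omega
        rw [graft, if_neg h, graft, if_neg (by omega), e1, iht _ _ (by omega) (by omega), graft,
          if_neg (by omega), graft, if_neg h]

theorem eq_leaf_of_numLeaves_eq_one (t : PTree ι) (ht : t.numLeaves = 1) : t = leaf := by
  cases t with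
  | leaf => rfl
  | node e s t =>
      have h1 := numLeaves_pos s
      have h2 := numLeaves_pos t
      simp only [numLeaves] at ht
      omega

theorem exists_eq_corolla_of_numLeaves_eq_two (t : PTree ι) (ht : t.numLeaves = 2) :
    ∃ e, t = node e leaf leaf := by
  cases t with
  | leaf => simp [numLeaves] at ht
  | node e s t =>
      have h1 := numLeaves_pos s
      have h2 := numLeaves_pos t
      simp only [numLeaves] at ht
      exact ⟨e, by rw [eq_leaf_of_numLeaves_eq_one s (by omega),
        eq_leaf_of_numLeaves_eq_one t (by omega)]⟩

/-- The only vertex is the root, which precedes both leaves. Hence both leaves of a corolla give the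
same sign in `squareTerm_add_of_eq`. -/
theorem nodesAfter_eq_zero_of_numLeaves_eq_two (t : PTree ι) (ht : t.numLeaves = 2) (i : ℕ) :
    t.nodesAfter i = 0 := by
  obtain ⟨e, rfl⟩ := exists_eq_corolla_of_numLeaves_eq_two t ht
  simp [nodesAfter, numNodes]

end PTree

namespace TreeOf

variable {ι : Type u}

theorem corolla_bijective : Function.Bijective (corolla : ι → TreeOf ι 2) := by
  refine ⟨fun e f h => ?_, fun t => ?_⟩
  · have h1 : (PTree.node e .leaf .leaf : PTree ι) = .node f .leaf .leaf := congrArg Subtype.val h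
    exact (PTree.node.inj h1).1
  · obtain ⟨e, he⟩ := PTree.exists_eq_corolla_of_numLeaves_eq_two t.1 t.2
    exact ⟨e, Subtype.ext he.symm⟩

/-- Every tree with three leaves is a grafting of two corollas in exactly one way. -/
theorem graft_two_two_bijective : Function.Bijective
    (fun x : Fin 2 × TreeOf ι 2 × TreeOf ι 2 => (graft (n := 3) (p := 2) (q := 2) rfl x.1 x.2.1 x.2.2)) := by
  constructor
  · rintro ⟨i, u, v⟩ ⟨j, u', v'⟩ h
    obtain ⟨e, rfl⟩ := corolla_bijective.2 u
    obtain ⟨f, rfl⟩ := corolla_bijective.2 v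
    obtain ⟨e', rfl⟩ := corolla_bijective.2 u'
    obtain ⟨f', rfl⟩ := corolla_bijective.2 v'
    have h1 := congrArg Subtype.val h
    fin_cases i <;> fin_cases j <;>
      simp_all [graft, corolla, PTree.graft, PTree.numLeaves]
  · rintro ⟨t, ht⟩
    cases t with
    | leaf => simp [PTree.numLeaves] at ht
    | node e s t =>
        have h1 := PTree.numLeaves_pos s
        have h2 := PTree.numLeaves_pos t
        simp only [PTree.numLeaves] at ht
        -- Of the two subtrees of the root one is a leaf and the other a corolla; the side of the
        -- corolla is the grafting position.
        rcases Nat.lt_or_ge s.numLeaves 2 with h | h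
        · obtain rfl := PTree.eq_leaf_of_numLeaves_eq_one s (by omega)
          exact ⟨(1, corolla e, ⟨t, by simp only [PTree.numLeaves] at ht; omega⟩), Subtype.ext
            (by simp [graft, corolla, PTree.graft, PTree.numLeaves])⟩
        · obtain rfl := PTree.eq_leaf_of_numLeaves_eq_one t (by omega)
          exact ⟨(0, corolla e, ⟨s, by simp only [PTree.numLeaves] at ht; omega⟩), Subtype.ext
            (by simp [graft, corolla, PTree.graft, PTree.numLeaves])⟩

end TreeOf

/-! ### Coordinates on the trees of the left tensor factor. -/

section Coordinates

variable {k : Type v} [Field k] {ι : Type u}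

/-- The coordinate of an element of `T(E)_n ⊗ X` on a tree. -/
noncomputable def treeCoord {n : ℕ} (s : TreeOf ι n) (X : Type w) [AddCommGroup X] [Module k X] :
    TreeModule k ι n ⊗[k] X →ₗ[k] X :=
  (TensorProduct.lid k X).toLinearMap ∘ₗ LinearMap.rTensor X (Finsupp.lapply s)

theorem treeCoord_tmul {n : ℕ} (s : TreeOf ι n) {X : Type w} [AddCommGroup X] [Module k X]
    (x : TreeModule k ι n) (y : X) : treeCoord s X (x ⊗ₜ[k] y) = x s • y := by
  simp [treeCoord]

theorem treeCoord_ext {n : ℕ} {X : Type w} [AddCommGroup X] [Module k X]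
    {x y : TreeModule k ι n ⊗[k] X} (h : ∀ s, treeCoord s X x = treeCoord s X y) : x = y := by
  classical
  refine (TensorProduct.finsuppScalarLeft k X (TreeOf ι n)).injective (Finsupp.ext fun s => ?_)
  rw [TensorProduct.finsuppScalarLeft_apply, TensorProduct.finsuppScalarLeft_apply]
  exact h s

/-- The coordinate of an element of `C_n ⊗ X` on a tree, for a subspace `C_n` of `T(E)_n`. -/
noncomputable def subCoord {n : ℕ} (C : Submodule k (TreeModule k ι n)) (s : TreeOf ι n)
    (X : Type w) [AddCommGroup X] [Module k X] : C ⊗[k] X →ₗ[k] X :=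
  treeCoord s X ∘ₗ LinearMap.rTensor X C.subtype

theorem subCoord_tmul {n : ℕ} (C : Submodule k (TreeModule k ι n)) (s : TreeOf ι n) {X : Type w}
    [AddCommGroup X] [Module k X] (x : C) (y : X) :
    subCoord C s X (x ⊗ₜ[k] y) = (x : TreeModule k ι n) s • y :=
  treeCoord_tmul s _ y

/-- `C` need not be spanned by trees, but `X` is flat over the field, so `C ⊗ X` embeds in the
tensor product with the whole tree module, where coordinates separate elements. -/
theorem subCoord_ext {n : ℕ} {C : Submodule k (TreeModule k ι n)} {X : Type w} [AddCommGroup X]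
    [Module k X] {x y : C ⊗[k] X} (h : ∀ s, subCoord C s X x = subCoord C s X y) : x = y :=
  Module.Flat.rTensor_preserves_injective_linearMap C.subtype (Submodule.injective_subtype _)
    (treeCoord_ext h)

theorem treeCoord_mapIncl_mem {p q : ℕ} (C : Submodule k (TreeModule k ι p))
    (D : Submodule k (TreeModule k ι q)) (s : TreeOf ι p) (z : C ⊗[k] D) :
    treeCoord s _ (TensorProduct.mapIncl C D z) ∈ D := by
  induction z using TensorProduct.induction_on with
  | zero => simp
  | add x y hx hy => rw [map_add, map_add]; exact D.add_mem hx hy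
  | tmul x y =>
      rw [TensorProduct.mapIncl, TensorProduct.map_tmul, treeCoord_tmul]
      exact D.smul_mem _ y.2

variable [Finite ι]

/-- Dual form of `decomp`: once the left factor `s` is fixed, each `u` receives the coefficient of
`x` on the single tree obtained by grafting. All later computations with Δ_(1) use this form. -/
theorem treeCoord_decomp {n p q : ℕ} (h : n + 1 = p + q) (l : Fin p) (s : TreeOf ι p)
    (x : TreeModule k ι n) :
    treeCoord s _ (decomp k ι n p q l x) = ∑ u : TreeOf ι q,
      ((-1 : k) ^ ((q - 1) * s.1.nodesAfter l) * x (TreeOf.graft h l s u)) •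
        (Finsupp.single u 1 : TreeModule k ι q) := by
  classical
  induction x using Finsupp.induction_linear with
  | zero => simp
  | add x y hx hy =>
      simp only [map_add, hx, hy, ← Finset.sum_add_distrib, Finsupp.add_apply, mul_add, add_smul]
  | single t c =>
      simp only [decomp, Finsupp.linearCombination_single, map_smul, map_sum]
      -- For a basis element `t`, only the pairs with left factor `s` survive the coordinate.
      rw [Finset.sum_eq_single s, Finset.smul_sum]
      · refine Finset.sum_congr rfl fun u _ => ?_
        rw [Finsupp.single_apply]
        have hiff : PTree.graft s.1 l u.1 = t.1 ↔ t = TreeOf.graft h l s u :=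
          ⟨fun e => Subtype.ext e.symm, fun e => (congrArg Subtype.val e).symm⟩
        by_cases ht : t = TreeOf.graft h l s u
        · rw [if_pos (hiff.2 ht), if_pos ht, map_smul, treeCoord_tmul, Finsupp.single_eq_same,
            one_smul, smul_smul, mul_comm]
        · rw [if_neg (fun e => ht (hiff.1 e)), if_neg ht]
          simp
      · intro s' _ hs'
        refine Finset.sum_eq_zero fun u _ => ?_
        split_ifs
        · rw [map_smul, treeCoord_tmul, Finsupp.single_eq_of_ne (Ne.symm hs'), zero_smul, smul_zero]
        · simp
      · simp

theorem koszulDual_three_le (R : Submodule k (TreeModule k ι 3)) : koszulDual R 3 ≤ R :=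
  sSup_le (by rintro _ ⟨C, _, h3, rfl⟩; exact h3)

theorem mapIncl_koszulDecomp (R : Submodule k (TreeModule k ι 3)) (n p q : ℕ) (l : Fin p)
    (x : koszulDual R n) :
    TensorProduct.mapIncl (koszulDual R p) (koszulDual R q) (koszulDecomp R n p q l x) =
      decomp k ι n p q l x := by
  have := (LinearEquiv.ofInjective _ (koszulDual_mapIncl_injective R p q)).apply_symm_apply
    (LinearMap.codRestrict _ ((decomp k ι n p q l) ∘ₗ (koszulDual R n).subtype)
      (fun x => koszulDual_isSubcooperad R n p q l x.1 x.2) x)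
  exact congrArg Subtype.val this

/-- The coordinate of `Δ_(1)` on a tree of its left factor maps the Koszul dual cooperad to itself. -/
theorem sum_graft_smul_mem_koszulDual (R : Submodule k (TreeModule k ι 3)) {n p q : ℕ}
    (h : n + 1 = p + q) (l : Fin p) (s : TreeOf ι p) (x : koszulDual R n) :
    ∑ u : TreeOf ι q, ((-1 : k) ^ ((q - 1) * s.1.nodesAfter l) *
        (x : TreeModule k ι n) (TreeOf.graft h l s u)) •
          (Finsupp.single u 1 : TreeModule k ι q) ∈ koszulDual R q := by
  rw [← treeCoord_decomp, ← mapIncl_koszulDecomp]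
  exact treeCoord_mapIncl_mem _ _ s _

end Coordinates

/-! ### Composition of contractions of blocks of A^{⊗ n}. -/

section Contraction

/-- The two blocks are disjoint, so the order is immaterial; the later block starts at `m + 1`
before the earlier one is contracted and at `m` afterwards. -/
theorem contractSeq_contractSeq_of_lt {A : Type w} {n : ℕ} (l m : ℕ) (hlm : l < m) (hm : m < n)
    (f g : (Fin 2 → A) → A) (a : Fin (n + 2) → A) :
    contractSeq (n := n + 1) (p := n) (q := 2) rfl ⟨l, by omega⟩ f
        (contractSeq (n := n + 2) (p := n + 1) (q := 2) rfl ⟨m + 1, by omega⟩ g a) =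
      contractSeq (n := n + 1) (p := n) (q := 2) rfl ⟨m, hm⟩ g
        (contractSeq (n := n + 2) (p := n + 1) (q := 2) rfl ⟨l, by omega⟩ f a) := by
  funext j
  rcases lt_trichotomy (j : ℕ) l with h1 | h1 | h1
  · have e1 : (j : ℕ) < m := by omega
    have e2 : (j : ℕ) < m + 1 := by omega
    simp [contractSeq, h1, e1, e2]
  · have e1 : l < m + 1 := by omega
    simp only [contractSeq, h1, lt_irrefl, dif_pos, dif_neg, not_false_eq_true, hlm]
    congr 1
    funext t
    have e2 : l + (t : ℕ) < m + 1 := by omega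
    simp [e2]
  · have n1 : ¬ (j : ℕ) < l := by omega
    have n2 : ¬ (j : ℕ) = l := by omega
    rcases lt_trichotomy (j : ℕ) m with h2 | h2 | h2
    · simp [contractSeq, n1, n2, h2]
    · have e2 : m + 2 - 1 = m + 1 := by omega
      have e3 : ¬ m < l := by omega
      have e4 : ¬ m = l := by omega
      simp only [contractSeq, h2, e2, e3, e4, dif_neg, not_false_eq_true, dif_pos, lt_irrefl]
      congr 1
      funext t
      have e3 : ¬ m + (t : ℕ) < l := by omega
      have e4 : ¬ m + (t : ℕ) = l := by omega
      simp only [e3, e4, dif_neg, not_false_eq_true]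
      congr 1
      exact Fin.ext (by simp only; omega)
    · have e1 : ¬ (j : ℕ) + 2 - 1 < m + 1 := by omega
      have e2 : ¬ (j : ℕ) + 2 - 1 = m + 1 := by omega
      have e3 : ¬ (j : ℕ) < m := by omega
      have e4 : ¬ (j : ℕ) = m := by omega
      have e5 : ¬ (j : ℕ) + 2 - 1 < l := by omega
      have e6 : ¬ (j : ℕ) + 2 - 1 = l := by omega
      simp only [contractSeq, n1, n2, e1, e2, e3, e4, e5, e6, dif_neg, not_false_eq_true]

/-- The output of `g` is an input of `f`, so the two contractions amount to one contraction of a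
block of three entries. -/
theorem contractSeq_contractSeq_add {A : Type w} {n : ℕ} (l : Fin n) (i : Fin 2) (f g : (Fin 2 → A) → A)
    (a : Fin (n + 2) → A) :
    contractSeq (n := n + 1) (p := n) (q := 2) rfl l f
        (contractSeq (n := n + 2) (p := n + 1) (q := 2) rfl ⟨l + i, by omega⟩ g a) =
      contractSeq (n := n + 2) (p := n) (q := 3) rfl l
        (fun b => f (contractSeq (n := 3) (p := 2) (q := 2) rfl i g b)) a := by
  have hl := l.2
  funext j
  rcases lt_trichotomy (j : ℕ) l with h1 | h1 | h1
  · have e1 : (j : ℕ) < l + i := by omega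
    simp [contractSeq, h1, e1]
  · simp only [contractSeq, h1, lt_irrefl, dif_pos, dif_neg, not_false_eq_true]
    congr 1
    funext t
    simp only [add_lt_add_iff_left, add_right_inj, add_assoc]
    split_ifs with h2 h3
    · rw [contractSeq, dif_pos h2]
    · rw [contractSeq, dif_neg h2, dif_pos h3]
    · rw [contractSeq, dif_neg h2, dif_neg h3]
      congr 1
  · have n1 : ¬ (j : ℕ) < l := by omega
    have n2 : ¬ (j : ℕ) = l := by omega
    have e1 : ¬ (j : ℕ) + 2 - 1 < l + i := by omega
    have e2 : ¬ (j : ℕ) + 2 - 1 = l + i := by omega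
    simp only [contractSeq, n1, n2, e1, e2, dif_neg, not_false_eq_true]
    congr 1

variable {k : Type v} [Field k] {ι : Type u} {A : Type w} [AddCommGroup A] [Module k A]

theorem contract_tprod {n p q : ℕ} (h : n + 1 = p + q) (l : Fin p)
    (f : MultilinearMap k (fun _ : Fin q => A) A) (a : Fin n → A) :
    contract h l f (PiTensorProduct.tprod k a) =
      PiTensorProduct.tprod k (contractSeq h l f a) := by
  simp [contract]

/-- The contraction of a block of factors of `A^{⊗ n}` by the operation of a tree. -/
noncomputable def treeContract (op : ι → A →ₗ[k] A →ₗ[k] A) {n p q : ℕ} (h : n + 1 = p + q)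
    (l : Fin p) (u : TreeOf ι q) : (⨂[k] _ : Fin n, A) →ₗ[k] (⨂[k] _ : Fin p, A) :=
  contract h l (freeAction op q (Finsupp.single u 1))

theorem treeContract_comm (op : ι → A →ₗ[k] A →ₗ[k] A) {n : ℕ} (l m : ℕ) (hlm : l < m)
    (hm : m < n) (u v : TreeOf ι 2) (z : ⨂[k] _ : Fin (n + 2), A) :
    treeContract op (n := n + 1) (p := n) (q := 2) rfl ⟨l, by omega⟩ u
        (treeContract op (n := n + 2) (p := n + 1) (q := 2) rfl ⟨m + 1, by omega⟩ v z) =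
      treeContract op (n := n + 1) (p := n) (q := 2) rfl ⟨m, hm⟩ v
        (treeContract op (n := n + 2) (p := n + 1) (q := 2) rfl ⟨l, by omega⟩ u z) := by
  rw [← LinearMap.comp_apply, ← LinearMap.comp_apply]
  congr 1
  ext a
  simp only [treeContract, LinearMap.compMultilinearMap_apply, LinearMap.comp_apply,
    contract_tprod]
  rw [contractSeq_contractSeq_of_lt l m hlm hm]

/-- This matches `PTree.graft_graft_add`: nested contractions act by the grafted tree, because
`freeAction` respects partial composition. -/
theorem treeContract_treeContract_add (op : ι → A →ₗ[k] A →ₗ[k] A) {n : ℕ} (l : Fin n) (i : Fin 2)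
    (u v : TreeOf ι 2) (z : ⨂[k] _ : Fin (n + 2), A) :
    treeContract op (n := n + 1) (p := n) (q := 2) rfl l u
        (treeContract op (n := n + 2) (p := n + 1) (q := 2) rfl ⟨l + i, by omega⟩ v z) =
      treeContract op (n := n + 2) (p := n) (q := 3) rfl l
        (TreeOf.graft (n := 3) (p := 2) (q := 2) rfl i u v) z := by
  rw [← LinearMap.comp_apply]
  congr 1
  ext a
  simp only [treeContract, LinearMap.compMultilinearMap_apply, LinearMap.comp_apply,
    contract_tprod]
  rw [contractSeq_contractSeq_add]
  have hc : partialComp (n := 3) (p := 2) (q := 2) rfl i (Finsupp.single u 1 : TreeModule k ι 2)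
      (Finsupp.single v 1 : TreeModule k ι 2) =
      Finsupp.single (TreeOf.graft (n := 3) (p := 2) (q := 2) rfl i u v) 1 := by
    simp [partialComp, Finsupp.linearCombination_single]
  rw [← hc]
  congr 2
  funext b
  rw [freeAction_partialComp]

theorem freeAction_generator [Fintype ι] (op : ι → A →ₗ[k] A →ₗ[k] A) (c : ι → k)
    (a : Fin 2 → A) : freeAction op 2 (generator k c) a = ∑ e, c e • op e (a 0) (a 1) := by
  rw [generator, map_sum, sum_apply]
  refine Finset.sum_congr rfl fun e _ => ?_
  have hs : (Finsupp.single (TreeOf.corolla e) (c e) : TreeModule k ι 2) =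
      c e • Finsupp.single (TreeOf.corolla e) 1 := by simp
  -- The extension of `a` by zero is harmless, since a corolla reads only the entries 0 and 1.
  rw [hs, map_smul, smul_apply, freeAction_single op _ a
    (fun i => if hi : i < 2 then a ⟨i, hi⟩ else 0) (fun j => dif_pos j.2)]
  simp [TreeOf.corolla, seqEval, PTree.numLeaves]

end Contraction

/-! ### The differential in tree coordinates. -/

section Differential

variable {k : Type v} [Field k] {ι : Type u} [Finite ι] {A : Type w} [AddCommGroup A] [Module k A]
  (R : Submodule k (TreeModule k ι 3)) (op : ι → A →ₗ[k] A →ₗ[k] A)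

/-- The map `id ⊗ γ_A`, applied to the block of two factors at the position `l`. -/
noncomputable def actBinary {n : ℕ} (l : Fin n) :
    (koszulDual R n ⊗[k] TreeModule k ι 2) ⊗[k] (⨂[k] _ : Fin (n + 1), A) →ₗ[k]
      KoszulComponent R A n :=
  TensorProduct.map LinearMap.id (TensorProduct.lift
      (contract (n := n + 1) (p := n) (q := 2) rfl l ∘ₗ freeAction op 2)) ∘ₗ
    (TensorProduct.assoc k _ _ _).toLinearMap

theorem actBinary_tmul {n : ℕ} (l : Fin n) (x : koszulDual R n) (y : TreeModule k ι 2)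
    (z : ⨂[k] _ : Fin (n + 1), A) :
    actBinary R op l ((x ⊗ₜ y) ⊗ₜ z) =
      x ⊗ₜ contract (n := n + 1) (p := n) (q := 2) rfl l (freeAction op 2 y) z := rfl

variable (hop : SatisfiesRelations R op)

theorem koszulDifferentialPart_eq_zero {n p q : ℕ} (h : n + 1 = p + q) (l : Fin p) (hq : q ≠ 2) :
    koszulDifferentialPart R op hop h l = 0 := by
  have h0 : koszulMorphism R q = 0 := if_neg hq
  have h1 : TensorProduct.lift (0 : koszulDual R q →ₗ[k] (⨂[k] _ : Fin n, A) →ₗ[k]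
      (⨂[k] _ : Fin p, A)) = 0 := by
    ext
    simp
  rw [koszulDifferentialPart, h0, LinearMap.comp_zero, LinearMap.comp_zero, h1,
    TensorProduct.map_zero_right, LinearMap.zero_comp, smul_zero]

/-- In arity two κ is the inclusion followed by the passage to P(E, R), and γ_A on a class is the
free action of any representative. So the quotient by the relations can be forgotten. -/
theorem koszulDifferentialPart_two_tmul {n : ℕ} (l : Fin n) (x : koszulDual R (n + 1))
    (z : ⨂[k] _ : Fin (n + 1), A) :
    koszulDifferentialPart R op hop (n := n + 1) (p := n) (q := 2) rfl l (x ⊗ₜ z) =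
      (-1 : k) ^ (n - 1) • actBinary R op l
        (LinearMap.lTensor (koszulDual R n) (koszulDual R 2).subtype
          (koszulDecomp R (n + 1) n 2 l x) ⊗ₜ z) := by
  rw [koszulDifferentialPart, LinearMap.smul_apply]
  congr 1
  simp only [LinearMap.comp_apply, TensorProduct.map_tmul, LinearMap.id_apply]
  generalize koszulDecomp R (n + 1) n 2 l x = y
  induction y using TensorProduct.induction_on with
  | zero => simp
  | add y y' hy hy' => simp only [TensorProduct.add_tmul, map_add, hy, hy']
  | tmul y y' => rfl

theorem koszulDifferential_lof_zero (z : KoszulComponent R A 0) :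
    koszulDifferential R op hop (DirectSum.lof k ℕ (KoszulComponent R A) 0 z) = 0 := by
  rw [koszulDifferential, DirectSum.toModule_lof, LinearMap.sum_apply]
  refine Finset.sum_eq_zero fun p _ => ?_
  rw [LinearMap.sum_apply]
  refine Finset.sum_eq_zero fun l _ => ?_
  rw [koszulDifferentialPart_eq_zero _ _ _ _ _ (by omega)]
  simp

/-- An arity `n + 1` splits as `(p, 2)` only for `p = n`, and κ kills all the other components. -/
theorem koszulDifferential_lof_succ (n : ℕ) (z : KoszulComponent R A (n + 1)) :
    koszulDifferential R op hop (DirectSum.lof k ℕ (KoszulComponent R A) (n + 1) z) =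
      DirectSum.lof k ℕ (KoszulComponent R A) n (∑ l : Fin n,
        koszulDifferentialPart R op hop (n := n + 1) (p := n) (q := 2) rfl l z) := by
  rw [koszulDifferential, DirectSum.toModule_lof, LinearMap.sum_apply,
    Finset.sum_eq_single (⟨n, by omega⟩ : Fin (n + 1 + 2))]
  · rw [LinearMap.sum_apply, map_sum]
    refine Finset.sum_congr rfl fun l _ => ?_
    rw [LinearMap.comp_apply]
    congr 1
    -- The right arity occurs as `n + 1 + 1 - n`; it is made a variable so that it can be replaced
    -- by 2 in the dependent types.
    have key : ∀ (q : ℕ) (h : n + 1 + 1 = n + q), q = 2 →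
        koszulDifferentialPart R op hop (n := n + 1) (p := n) h l z =
          koszulDifferentialPart R op hop (n := n + 1) (p := n) (q := 2) rfl l z := by
      rintro q h rfl
      rfl
    exact key _ _ (by simp only; omega)
  · intro p _ hp
    rw [LinearMap.sum_apply]
    refine Finset.sum_eq_zero fun l _ => ?_
    have hp' : (p : ℕ) ≠ n := fun e => hp (Fin.ext e)
    rw [koszulDifferentialPart_eq_zero _ _ _ _ _ (by omega)]
    simp
  · simp

theorem subCoord_actBinary {n : ℕ} (l : Fin n) (s : TreeOf ι n)
    (y : koszulDual R n ⊗[k] koszulDual R 2) (z : ⨂[k] _ : Fin (n + 1), A) :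
    subCoord (koszulDual R n) s _ (actBinary R op l
        (LinearMap.lTensor (koszulDual R n) (koszulDual R 2).subtype y ⊗ₜ z)) =
      contract (n := n + 1) (p := n) (q := 2) rfl l (freeAction op 2
        (treeCoord s _ (TensorProduct.mapIncl (koszulDual R n) (koszulDual R 2) y))) z := by
  induction y using TensorProduct.induction_on with
  | zero => simp
  | add y y' hy hy' => simp only [TensorProduct.add_tmul, map_add, hy, hy', LinearMap.add_apply]
  | tmul y y' =>
      rw [LinearMap.lTensor_tmul, actBinary_tmul, subCoord_tmul, TensorProduct.mapIncl,
        TensorProduct.map_tmul, treeCoord_tmul, map_smul, map_smul, LinearMap.smul_apply]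
      rfl

/-- The action on A touches only the right factor, so taking the coordinate on `s` commutes with it.
Being stated for arbitrary `z`, the formula can be iterated to compute d². -/
theorem subCoord_koszulDifferentialPart {n : ℕ} (l : Fin n) (s : TreeOf ι n)
    (z : KoszulComponent R A (n + 1)) :
    subCoord (koszulDual R n) s _
        (koszulDifferentialPart R op hop (n := n + 1) (p := n) (q := 2) rfl l z) =
      (-1 : k) ^ (n - 1) • ∑ u : TreeOf ι 2, (-1 : k) ^ s.1.nodesAfter l •
        treeContract op (n := n + 1) (p := n) (q := 2) rfl l u
          (subCoord (koszulDual R (n + 1)) (TreeOf.graft (n := n + 1) (p := n) (q := 2) rfl l s u) _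
            z) := by
  induction z using TensorProduct.induction_on with
  | zero => simp
  | add y y' hy hy' =>
      simp only [map_add, hy, hy', smul_add, Finset.sum_add_distrib]
  | tmul x z =>
      rw [koszulDifferentialPart_two_tmul, map_smul, subCoord_actBinary, mapIncl_koszulDecomp,
        treeCoord_decomp (q := 2) rfl, map_sum, map_sum, LinearMap.sum_apply]
      congr 1
      refine Finset.sum_congr rfl fun u _ => ?_
      rw [map_smul, map_smul, LinearMap.smul_apply, subCoord_tmul, map_smul, smul_smul, treeContract]
      simp

/-- The point where the relations enter: the coefficients of `x` on the trees grafted on `s` at `l`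
form an element of C_3 ⊆ R, and R acts by zero on A. -/
theorem sum_graft_smul_treeContract_eq_zero {n : ℕ} (l : Fin n) (s : TreeOf ι n)
    (x : koszulDual R (n + 2)) (z : ⨂[k] _ : Fin (n + 2), A) (hop : SatisfiesRelations R op) :
    ∑ t : TreeOf ι 3, (x : TreeModule k ι (n + 2))
        (TreeOf.graft (n := n + 2) (p := n) (q := 3) rfl l s t) •
      treeContract op (n := n + 2) (p := n) (q := 3) rfl l t z = 0 := by
  have h1 := hop (koszulDual_three_le R
    (sum_graft_smul_mem_koszulDual R (n := n + 2) (p := n) (q := 3) rfl l s x))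
  rw [LinearMap.mem_ker, map_sum] at h1
  have h2 := congrArg
    (fun f => contract (k := k) (A := A) (n := n + 2) (p := n) (q := 3) rfl l f z) h1
  simp only [map_sum, map_smul, LinearMap.sum_apply, LinearMap.smul_apply, map_zero,
    LinearMap.zero_apply] at h2
  rw [← h2]
  refine Finset.sum_congr rfl fun t _ => ?_
  -- For `q = 3` two letters jump together, so the Koszul sign is a power of (-1)² = 1.
  rw [pow_mul]
  simp [treeContract]

end Differential

/-- A double sum vanishes when its terms cancel as in the identity `d ∘ d = 0` of a
pre-simplicial object, the terms next to the diagonal cancelling among themselves. -/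
theorem sum_sum_eq_zero_of_cancel {M : Type*} [AddCommGroup M] {n : ℕ}
    (T : Fin n → Fin (n + 1) → M)
    (hpar : ∀ (l m : ℕ) (hlm : l < m) (hm : m < n),
      T ⟨l, by omega⟩ ⟨m + 1, by omega⟩ + T ⟨m, hm⟩ ⟨l, by omega⟩ = 0)
    (hseq : ∀ l : Fin n, T l l.castSucc + T l l.succ = 0) :
    ∑ l, ∑ m, T l m = 0 := by
  -- The two terms next to the diagonal cancel within each row and are discarded.
  have hdiag : ∀ l : Fin n, ∑ m, T l m =
      ∑ m ∈ Finset.univ.filter (fun m : Fin (n + 1) => (m : ℕ) ≠ l ∧ (m : ℕ) ≠ l + 1), T l m := by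
    intro l
    rw [← Finset.sum_filter_add_sum_filter_not Finset.univ
      (fun m : Fin (n + 1) => (m : ℕ) ≠ l ∧ (m : ℕ) ≠ l + 1) (T l), add_eq_left, ← hseq l]
    have hs : Finset.univ.filter
        (fun m : Fin (n + 1) => ¬ ((m : ℕ) ≠ l ∧ (m : ℕ) ≠ l + 1)) = {l.castSucc, l.succ} := by
      ext m
      simp only [Finset.mem_filter, Finset.mem_univ, true_and, Finset.mem_insert,
        Finset.mem_singleton, Fin.ext_iff, Fin.val_castSucc, Fin.val_succ]
      omega
    rw [hs, Finset.sum_pair (by simp [Fin.ext_iff])]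
  simp only [hdiag]
  rw [Finset.sum_sigma']
  -- The index `m` belongs to the contraction done first. Exchanging the order shifts the index of
  -- the right-hand block by one: up if it now comes first, down if it now comes second.
  refine Finset.sum_involution
    (fun x hx => if h : (x.2 : ℕ) < x.1 then ⟨⟨x.2, by omega⟩, ⟨x.1 + 1, by omega⟩⟩
      else ⟨⟨x.2 - 1, by
        simp only [Finset.mem_sigma, Finset.mem_filter, Finset.mem_univ, true_and] at hx
        omega⟩, ⟨x.1, by omega⟩⟩) ?_ ?_ ?_ ?_
  · rintro ⟨⟨l, hl⟩, ⟨m, hm⟩⟩ hx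
    simp only [Finset.mem_sigma, Finset.mem_filter, Finset.mem_univ, true_and] at hx
    by_cases h : m < l
    · simp only [h, dif_pos]
      rw [add_comm]
      exact hpar m l h hl
    · simp only [h, dif_neg, not_false_eq_true]
      obtain ⟨m, rfl⟩ : ∃ m', m = m' + 1 := ⟨m - 1, by omega⟩
      exact hpar l m (by omega) (by omega)
  · rintro ⟨⟨l, hl⟩, ⟨m, hm⟩⟩ hx _ he
    simp only [Finset.mem_sigma, Finset.mem_filter, Finset.mem_univ, true_and] at hx
    have he' := congrArg (fun y : (_ : Fin n) × Fin (n + 1) => (y.1 : ℕ)) he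
    by_cases h : m < l
    · simp only [h, dif_pos] at he'
      omega
    · simp only [h, dif_neg, not_false_eq_true] at he'
      omega
  · rintro ⟨⟨l, hl⟩, ⟨m, hm⟩⟩ hx
    simp only [Finset.mem_sigma, Finset.mem_filter, Finset.mem_univ, true_and] at hx ⊢
    by_cases h : m < l
    · simp only [h, dif_pos]
      omega
    · simp only [h, dif_neg, not_false_eq_true]
      omega
  · rintro ⟨⟨l, hl⟩, ⟨m, hm⟩⟩ hx
    simp only [Finset.mem_sigma, Finset.mem_filter, Finset.mem_univ, true_and] at hx
    by_cases h : m < l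
    · have h' : ¬ l + 1 < m := by omega
      simp [h, h']
    · have h' : l < m - 1 := by omega
      have h'' : m - 1 + 1 = m := by omega
      simp [h, h', h'']

/-! ### The identity d ∘ d = 0. -/

section Square

variable {k : Type v} [Field k] {ι : Type u} [Finite ι] {A : Type w} [AddCommGroup A] [Module k A]
  (R : Submodule k (TreeModule k ι 3)) (op : ι → A →ₗ[k] A →ₗ[k] A)

/-- The term of the coordinate of `d²(x ⊗ z)` on the tree `s` for a pair of positions. -/
noncomputable def squareTerm {n : ℕ} (s : TreeOf ι n) (x : koszulDual R (n + 2))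
    (z : ⨂[k] _ : Fin (n + 2), A) (l : Fin n) (m : Fin (n + 1)) : ⨂[k] _ : Fin n, A :=
  ∑ u : TreeOf ι 2, ∑ v : TreeOf ι 2,
    (-1 : k) ^ (s.1.nodesAfter l + (s.1.graft l u.1).nodesAfter m) •
      (x : TreeModule k ι (n + 2)) (TreeOf.graft (n := n + 2) (p := n + 1) (q := 2) rfl m
          (TreeOf.graft (n := n + 1) (p := n) (q := 2) rfl l s u) v) •
        treeContract op (n := n + 1) (p := n) (q := 2) rfl l u
          (treeContract op (n := n + 2) (p := n + 1) (q := 2) rfl m v z)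

variable {R op} in
theorem squareTerm_add_of_lt {n : ℕ} (s : TreeOf ι n) (x : koszulDual R (n + 2))
    (z : ⨂[k] _ : Fin (n + 2), A) (l m : ℕ) (hlm : l < m) (hm : m < n) :
    squareTerm R op s x z ⟨l, by omega⟩ ⟨m + 1, by omega⟩ +
      squareTerm R op s x z ⟨m, hm⟩ ⟨l, by omega⟩ = 0 := by
  -- In the second term the first grafted corolla sits at `m`, so it is the `v` of the first term;
  -- swapping the sums there pairs the terms.
  rw [squareTerm, squareTerm, Finset.sum_comm, ← Finset.sum_add_distrib]
  refine Finset.sum_eq_zero fun v _ => ?_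
  rw [← Finset.sum_add_distrib]
  refine Finset.sum_eq_zero fun u _ => ?_
  have hs : m < s.1.numLeaves := by rw [s.2]; exact hm
  have e1 := PTree.nodesAfter_graft_of_gt s.1 u.1 l m hlm hs
  have e2 := PTree.nodesAfter_graft_of_lt s.1 v.1 m l hlm hs
  have e3 := PTree.numLeaves_eq_numNodes_add_one v.1
  have e4 := PTree.graft_graft_of_lt s.1 u.1 v.1 l m hlm hs
  rw [u.2] at e1 e4
  rw [v.2] at e3
  have e5 : TreeOf.graft (n := n + 2) (p := n + 1) (q := 2) rfl ⟨m + 1, by omega⟩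
        (TreeOf.graft (n := n + 1) (p := n) (q := 2) rfl ⟨l, by omega⟩ s u) v =
      TreeOf.graft (n := n + 2) (p := n + 1) (q := 2) rfl ⟨l, by omega⟩
        (TreeOf.graft (n := n + 1) (p := n) (q := 2) rfl ⟨m, hm⟩ s v) u := Subtype.ext e4
  have e6 : v.1.numNodes = 1 := by omega
  have e7 : (s.1.graft l u.1).nodesAfter (m + 1) = s.1.nodesAfter m := e1
  simp only
  rw [e5, treeContract_comm op l m hlm hm, e7, e2, e6, ← add_smul, ← add_assoc,
    add_comm (s.1.nodesAfter m), pow_succ, mul_neg_one, add_neg_cancel, zero_smul]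

theorem squareTerm_add_of_eq (hop : SatisfiesRelations R op) {n : ℕ} (s : TreeOf ι n)
    (x : koszulDual R (n + 2)) (z : ⨂[k] _ : Fin (n + 2), A) (l : Fin n) :
    squareTerm R op s x z l l.castSucc + squareTerm R op s x z l l.succ = 0 := by
  have key : ∀ i : Fin 2, squareTerm R op s x z l ⟨l + i, by omega⟩ =
      ∑ u : TreeOf ι 2, ∑ v : TreeOf ι 2, (x : TreeModule k ι (n + 2))
        (TreeOf.graft (n := n + 2) (p := n) (q := 3) rfl l s
          (TreeOf.graft (n := 3) (p := 2) (q := 2) rfl i u v)) •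
        treeContract op (n := n + 2) (p := n) (q := 3) rfl l
          (TreeOf.graft (n := 3) (p := 2) (q := 2) rfl i u v) z := by
    intro i
    rw [squareTerm]
    refine Finset.sum_congr rfl fun u _ => Finset.sum_congr rfl fun v _ => ?_
    have hl : (l : ℕ) < s.1.numLeaves := by rw [s.2]; exact l.2
    have hi : (i : ℕ) < u.1.numLeaves := by rw [u.2]; exact i.2
    have e1 : TreeOf.graft (n := n + 2) (p := n + 1) (q := 2) rfl ⟨l + i, by omega⟩
          (TreeOf.graft (n := n + 1) (p := n) (q := 2) rfl l s u) v =
        TreeOf.graft (n := n + 2) (p := n) (q := 3) rfl l s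
          (TreeOf.graft (n := 3) (p := 2) (q := 2) rfl i u v) :=
      Subtype.ext (PTree.graft_graft_add s.1 u.1 v.1 l i hl hi)
    rw [treeContract_treeContract_add, e1, PTree.nodesAfter_graft_add s.1 u.1 l i hl hi,
      PTree.nodesAfter_eq_zero_of_numLeaves_eq_two u.1 u.2, add_zero, ← two_mul, pow_mul,
      neg_one_sq, one_pow, one_smul]
  have h := sum_graft_smul_treeContract_eq_zero R op l s x z hop
  -- The trees with three leaves are listed by the leaf `i` of `u` that carries `v`; the two values
  -- of `i` are the two positions `l` and `l + 1`.
  rw [← TreeOf.graft_two_two_bijective.sum_comp, Fintype.sum_prod_type, Fin.sum_univ_two,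
    Fintype.sum_prod_type, Fintype.sum_prod_type] at h
  rw [← h]
  exact congrArg₂ _ (key 0) (key 1)

theorem koszulDifferential_comp_self (hop : SatisfiesRelations R op) :
    koszulDifferential R op hop ∘ₗ koszulDifferential R op hop = 0 := by
  refine DirectSum.linearMap_ext k fun n => LinearMap.ext fun z => ?_
  simp only [LinearMap.comp_apply, LinearMap.zero_apply]
  match n with
  | 0 => rw [koszulDifferential_lof_zero, map_zero]
  | 1 => rw [koszulDifferential_lof_succ, koszulDifferential_lof_zero]
  | n + 2 =>
    rw [koszulDifferential_lof_succ, koszulDifferential_lof_succ]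
    have h0 : ∑ l : Fin n, koszulDifferentialPart R op hop (n := n + 1) (p := n) (q := 2) rfl l
        (∑ m : Fin (n + 1),
          koszulDifferentialPart R op hop (n := n + 2) (p := n + 1) (q := 2) rfl m z) = 0 := by
      refine subCoord_ext fun s => ?_
      rw [map_zero]
      induction z using TensorProduct.induction_on with
      | zero => simp
      | add z z' hz hz' => simp only [map_add, Finset.sum_add_distrib, hz, hz', add_zero]
      | tmul x z =>
        have key : ∀ l m, subCoord (koszulDual R n) s _
            (koszulDifferentialPart R op hop (n := n + 1) (p := n) (q := 2) rfl l
              (koszulDifferentialPart R op hop (n := n + 2) (p := n + 1) (q := 2) rfl m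
                (x ⊗ₜ[k] z))) =
            -- The signs of the two passages of κ depend only on the arity, so they factor out of
            -- the double sum.
            ((-1 : k) ^ (n - 1) * (-1 : k) ^ n) • squareTerm R op s x z l m := by
          intro l m
          rw [subCoord_koszulDifferentialPart, mul_smul, squareTerm]
          congr 1
          rw [Finset.smul_sum]
          refine Finset.sum_congr rfl fun u _ => ?_
          rw [subCoord_koszulDifferentialPart, map_smul, smul_comm, map_sum, Finset.smul_sum]
          congr 1
          refine Finset.sum_congr rfl fun v _ => ?_
          rw [subCoord_tmul, map_smul, map_smul, map_smul, smul_smul, ← pow_add]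
          rfl
        simp only [map_sum, key]
        simp only [← Finset.smul_sum]
        rw [sum_sum_eq_zero_of_cancel (squareTerm R op s x z) (squareTerm_add_of_lt s x z)
          (squareTerm_add_of_eq R op hop s x z), smul_zero]
    rw [h0, map_zero]

end Square

/-! ### The explicit formula for d. -/

section Formula

variable {k : Type v} [Field k] {ι : Type u} [Fintype ι] {A : Type w} [AddCommGroup A] [Module k A]

/-- Every element of `C ⊗ T(E)_2` is a combination of generators with coefficients in `C`. -/
theorem exists_sum_tmul_generator {M : Type*} [AddCommMonoid M] [Module k M] [DecidableEq ι]
    (y : M ⊗[k] TreeModule k ι 2) :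
    ∃ ξ : ι → M, y = ∑ e, ξ e ⊗ₜ[k] generator k (Pi.single e 1) := by
  have hg : ∀ e : ι, generator k (Pi.single e 1) =
      (Finsupp.single (TreeOf.corolla e) 1 : TreeModule k ι 2) := by
    intro e
    rw [generator, Finset.sum_eq_single e]
    · simp
    · intro f _ hf
      simp [Pi.single_eq_of_ne hf]
    · simp
  simp only [hg]
  induction y using TensorProduct.induction_on with
  | zero => exact ⟨0, by simp⟩
  | add y y' hy hy' =>
      obtain ⟨ξ, rfl⟩ := hy
      obtain ⟨ξ', rfl⟩ := hy'
      exact ⟨ξ + ξ', by simp [TensorProduct.add_tmul, Finset.sum_add_distrib]⟩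
  | tmul x y =>
      -- The trees with two leaves are exactly the corollas, so these are all the coordinates of
      -- `y`.
      refine ⟨fun e => y (TreeOf.corolla e) • x, ?_⟩
      simp only [TensorProduct.smul_tmul, ← TensorProduct.tmul_sum]
      congr 1
      ext t
      obtain ⟨e, rfl⟩ := TreeOf.corolla_bijective.2 t
      rw [Finsupp.finsetSum_apply, Finset.sum_eq_single e]
      · simp
      · intro f _ hf
        have : TreeOf.corolla e ≠ TreeOf.corolla f :=
          fun h => hf (TreeOf.corolla_bijective.1 h).symm
        simp [Finsupp.single_eq_of_ne this]
      · simp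

/-- The exponent `n - 1` occurs twice, once from κ and once from the interchange of factors in the
Hadamard product; the two cancel and leave the sign (-1)^i of S^c. -/
theorem koszulDifferentialPart_tmul_tprod (R : Submodule k (TreeModule k ι 3))
    (op : ι → A →ₗ[k] A →ₗ[k] A) (hop : SatisfiesRelations R op) {n N : ℕ} (i : Fin n)
    (x : koszulDual R (n + 1)) (ξ : Fin N → koszulDual R n) (c : Fin N → ι → k)
    (hx : LinearMap.lTensor (koszulDual R n) (koszulDual R 2).subtype
      (desuspendedDecomp R (n + 1) n 2 i x) = ∑ j, ξ j ⊗ₜ[k] generator k (c j))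
    (a : Fin (n + 1) → A) :
    koszulDifferentialPart R op hop (n := n + 1) (p := n) (q := 2) rfl i
        (x ⊗ₜ[k] PiTensorProduct.tprod k a) =
      (-1 : k) ^ (i : ℕ) • ∑ j, ξ j ⊗ₜ[k] PiTensorProduct.tprod k (fun r : Fin n =>
        if r < i then a r.castSucc
        else if r = i then ∑ e, c j e • op e (a i.castSucc) (a i.succ)
        else a r.succ) := by
  -- The desuspension sign is its own inverse.
  have hd : koszulDecomp R (n + 1) n 2 i x =
      ((-1 : k) ^ (i + (n - 1))) • desuspendedDecomp R (n + 1) n 2 i x := by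
    rw [desuspendedDecomp, LinearMap.smul_apply, smul_smul, ← pow_add]
    simp only [Nat.add_one_sub_one, one_mul]
    rw [← two_mul, pow_mul, neg_one_sq, one_pow, one_smul]
  rw [koszulDifferentialPart_two_tmul, hd, map_smul, hx, ← TensorProduct.smul_tmul', map_smul,
    smul_smul, ← pow_add]
  have hp : (-1 : k) ^ (n - 1 + (i + (n - 1))) = (-1 : k) ^ (i : ℕ) := by
    rw [show n - 1 + ((i : ℕ) + (n - 1)) = i + 2 * (n - 1) by omega, pow_add, pow_mul, neg_one_sq,
      one_pow, mul_one]
  rw [hp, TensorProduct.sum_tmul, map_sum]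
  congr 1
  refine Finset.sum_congr rfl fun j _ => ?_
  rw [actBinary_tmul, contract_tprod]
  congr 2
  funext r
  rw [contractSeq]
  rcases lt_trichotomy r i with h | h | h
  · rw [dif_pos (show (r : ℕ) < i from h), if_pos h]
    rfl
  · subst h
    rw [dif_neg (lt_irrefl _), dif_pos rfl, if_neg (lt_irrefl _), if_pos rfl, freeAction_generator]
    rfl
  · have h1 : ¬ (r : ℕ) < i := by omega
    have h2 : ¬ (r : ℕ) = i := by omega
    rw [dif_neg h1, dif_neg h2, if_neg (by omega), if_neg (by omega)]
    rfl

end Formula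

/-- Positions count from 0, so (-1)^i is the sign (-1)^{i+1} of the usual numbering. For `n = 0` the
sum is empty, which gives d = 0 on C_0(A). A common length `N` for all positions is no restriction,
as zero terms may be added. -/
theorem mainTheorem6 {k : Type v} [Field k] {A : Type w} [AddCommGroup A] [Module k A]
    (M : MatchingDialgebra k A) :
    (∀ (n : ℕ) (lam : AsTwoDual k (n + 1)),
      (∃ (N : ℕ) (ξ : Fin n → Fin N → AsTwoDual k n) (c : Fin n → Fin N → Fin 2 → k),
        ∀ i : Fin n,
          LinearMap.lTensor (AsTwoDual k n) (AsTwoDual k 2).subtype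
              (desuspendedDecomp (matchingRelations k) (n + 1) n 2 i lam) =
            ∑ j, ξ i j ⊗ₜ[k] generator k (c i j)) ∧
      (∀ (N : ℕ) (ξ : Fin n → Fin N → AsTwoDual k n) (c : Fin n → Fin N → Fin 2 → k),
        (∀ i : Fin n,
          LinearMap.lTensor (AsTwoDual k n) (AsTwoDual k 2).subtype
              (desuspendedDecomp (matchingRelations k) (n + 1) n 2 i lam) =
            ∑ j, ξ i j ⊗ₜ[k] generator k (c i j)) →
        ∀ a : Fin (n + 1) → A,
          M.d (DirectSum.lof k ℕ (KoszulComponent (matchingRelations k) A) (n + 1)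
              (lam ⊗ₜ[k] PiTensorProduct.tprod k a)) =
            DirectSum.lof k ℕ (KoszulComponent (matchingRelations k) A) n
              (∑ i : Fin n, (-1 : k) ^ (i : ℕ) • ∑ j,
                ξ i j ⊗ₜ[k] PiTensorProduct.tprod k (fun r : Fin n =>
                  if r < i then a r.castSucc
                  else if r = i then M.opE (c i j) (a i.castSucc) (a i.succ)
                  else a r.succ)))) ∧
    M.d ∘ₗ M.d = 0 := by
  refine ⟨fun n lam => ⟨?_, fun N ξ c hξ a => ?_⟩, koszulDifferential_comp_self _ _ _⟩
  · choose ξ hξ using fun i : Fin n => exists_sum_tmul_generator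
      (LinearMap.lTensor (AsTwoDual k n) (AsTwoDual k 2).subtype
        (desuspendedDecomp (matchingRelations k) (n + 1) n 2 i lam))
    -- Two terms suffice at each position, one for each of μ₁ and μ₂.
    exact ⟨2, ξ, fun _ j => Pi.single j 1, hξ⟩
  · rw [MatchingDialgebra.d, koszulDifferential_lof_succ]
    congr 1
    refine Finset.sum_congr rfl fun i _ => ?_
    rw [koszulDifferentialPart_tmul_tprod _ _ _ i lam (ξ i) (c i) (hξ i)]
    simp [MatchingDialgebra.opE, MatchingDialgebra.op, Fin.sum_univ_two]
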